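/- Consider a cluster of $N\ge 1$ LRU cache servers and countably many unit-size data items $d_1,d_2,\dots$. On a probability space let $H(d_i)\in\{1,\dots,N\}$, $i\ge1$, be independent with $\mathbb P[H(d_i)=m]=\mu_m$ for all $i$ and $m$ (simple uniform hashing), and let the requested items $(R_n)_{n\in\mathbb Z}$ be i.i.d., independent of $H=(H(d_i))_{i\ge1}$, with popularities $\mathbb P[R_n=d_i]=q_i$, where $(q_i)$ is non-increasing and $q_i\sim c/i^{\alpha}$ as $i\to\infty$ for some $c>0$ and $\alpha>1$. Let $J_n=H(R_n)$ be the server that processes the $n$-th request, and let $C_n$ be the position of the item $R_n$, just before the $n$-th request, in the move-to-front list of the server $J_n$, i.e. in the list of the items hashed to $J_n$ sorted by their last access time, most recent first. Let $W_m=1/\mathbb P[J_0=m\mid H]$. Then, almost surely in $H$, the following hold. (1) For every $m$ with $\mu_m>0$, as $x_m\to\infty$, $$\mathbb P[C_0>x_m\mid J_0=m,\,H]\;\sim\;\frac{(\mu_m\Gamma(1-1/\alpha))^{\alpha}\,c\,W_m}{\alpha\,x_m^{\alpha-1}}.$$ (2) The miss probability of the cluster with cache sizes $x_1,\dots,x_N$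 satisfies, as all of $x_1,\dots,x_N$ tend to infinity (in particular for $x_m=b_mx$ with fixed $b_m>0$ and $x\to\infty$), $$\sum_{m=1}^N\mathbb P[C_0>x_m\mid J_0=m,\,H]\,\mathbb P[J_0=m\mid H]\;\sim\;\sum_{m=1}^N\frac{\mu_m^{\alpha}\,\Gamma(1-1/\alpha)^{\alpha}\,c}{\alpha\,x_m^{\alpha-1}},$$ where a summand on the left with $\mathbb P[J_0=m\mid H]=0$ is $0$. The right-hand side does not depend on $H$. -/

import Mathlib

open MeasureTheory ProbabilityTheory Filter Asymptotics

noncomputable section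

namespace LRUCluster

/-- `MoreRecent r n d d'`: for the request sequence `r` (`r k` is the item requested at the `k`-th
arrival), just before the `n`-th arrival the last access to item `d` is more recent than the last
access to item `d'`: some past request for `d` has not been followed by a request for `d'`. -/
def MoreRecent (r : ℤ → ℕ) (n : ℤ) (d d' : ℕ) : Prop :=
  ∃ k < n, r k = d ∧ ∀ l, k ≤ l → l < n → r l ≠ d'

/-- Under the hash function `h`, the position, just before the `n`-th arrival, of item `d` in the
move-to-front list of the server `h d`, i.e. the list of the items hashed to this server sorted by
last access, most recent first: one plus the number of items of the server in front of `d`. -/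
def position {N : ℕ} (h : ℕ → Fin N) (r : ℤ → ℕ) (n : ℤ) (d : ℕ) : ℕ∞ :=
  Set.encard {d' | h d' = h d ∧ MoreRecent r n d' d} + 1

section RandomModel

variable {Ω : Type*} [MeasurableSpace Ω] {N : ℕ} [NeZero N]

/-- `J_n`: the server that processes the `n`-th request. -/
def server (H : ℕ → Ω → Fin N) (R : ℤ → Ω → ℕ) (n : ℤ) (ω : Ω) : Fin N :=
  H (R n ω) ω

/-- `C_n`: the position of the item of the `n`-th request in the move-to-front list of the server
that processes this request. -/
def searchCost (H : ℕ → Ω → Fin N) (R : ℤ → Ω → ℕ) (n : ℤ) (ω : Ω) : ℕ∞ :=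
  position (fun i => H i ω) (fun k => R k ω) n (R n ω)

/-- The regular conditional joint distribution of `(J_0, C_0)` given the hash function `H`. -/
def conditionalLaw (P : Measure Ω) [IsProbabilityMeasure P]
    (H : ℕ → Ω → Fin N) (R : ℤ → Ω → ℕ) : Kernel (ℕ → Fin N) (Fin N × ℕ∞) :=
  condDistrib (fun ω => (server H R 0 ω, searchCost H R 0 ω)) (fun ω i => H i ω) P

/-- `P[J_0 = m | H = h]`. -/
def serverProb (P : Measure Ω) [IsProbabilityMeasure P]
    (H : ℕ → Ω → Fin N) (R : ℤ → Ω → ℕ) (h : ℕ → Fin N) (m : Fin N) : ℝ :=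
  (conditionalLaw P H R h).real {y | y.1 = m}

/-- `P[C_0 > x | J_0 = m, H = h]`. -/
def serverMissProb (P : Measure Ω) [IsProbabilityMeasure P]
    (H : ℕ → Ω → Fin N) (R : ℤ → Ω → ℕ) (h : ℕ → Fin N) (m : Fin N) (x : ℝ) : ℝ :=
  (cond (conditionalLaw P H R h) {y | y.1 = m}).real {y | (x : EReal) < ((y.2 : ENNReal) : EReal)}

/-- The overall miss probability of the cluster given `H = h`, for cache sizes `x m`:
`∑ m, P[C_0 > x m | J_0 = m, H = h] * P[J_0 = m | H = h]`. -/
def clusterMissProb (P : Measure Ω) [IsProbabilityMeasure P]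
    (H : ℕ → Ω → Fin N) (R : ℤ → Ω → ℕ) (h : ℕ → Fin N) (x : Fin N → ℝ) : ℝ :=
  ∑ m, serverMissProb P H R h m (x m) * serverProb P H R h m

end RandomModel

end LRUCluster

end

/-! Requests and hash function are independent, so conditioning on H amounts to freezing a hash
function h (`conditionalLaw_ae_eq`). By the strong law, almost every h gives the item set S of
server m the density μ_m (`tendsto_count_hash_div`). From there on only the requests are random.

For fixed h, look at the last n requests. If the current item, lying in S, occurs among them, its
position is at most the number D of distinct items of S in this window; otherwise its position
exceeds D. Hence the joint probability of J_0 = m and C_0 > x differs from the unseen mass B(n) by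
at most a tail probability of D (`jointMissProb_le`, `le_jointMissProb`). Occupancy indicators are
negatively dependent, so D obeys Poisson-type Chernoff bounds around its mean M(n)
(`integral_pow_distinctCount_le`).

The number of items of S with popularity above t is asymptotic to μ c^(1/α) t^(-1/α) as t tends to
0. A layer-cake formula and dominated convergence turn this into M(n) ~ K n^(1/α) and B(n) ~ (K/α)
n^(1/α - 1), with K = μ c^(1/α) Γ(1 - 1/α). Taking n ≈ (ρx/K)^α makes M(n) ≈ ρx. For ρ ≠ 1 the
relevant tail is exponentially small in x, while B(n) ~ (K^α/α) ρ^(1-α) x^(1-α); letting ρ → 1 from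
either side gives the limit (`tendsto_of_chernoff_sandwich`). The servers are then summed, the terms
being nonnegative. -/

namespace LRUCluster

/-! ### Occupancy counts and their means -/

open Classical in
/-- The number of distinct elements of `S` among the values `r k`, `k ∈ I`. -/
noncomputable def distinctCount {ι : Type*} (S : Set ℕ) (I : Finset ι) (r : ι → ℕ) : ℕ :=
  ((I.image r).filter (· ∈ S)).card

/-- The expected number of distinct elements of `S` among `n` independent draws from `q`. -/
noncomputable def expectedDistinct (q : ℕ → ℝ) (S : Set ℕ) (n : ℕ) : ℝ :=
  ∑' i, S.indicator (fun i => 1 - (1 - q i) ^ n) i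

/-- The probability that a draw from `q` lies in `S` and is not among `n` further
independent draws. -/
noncomputable def unseenMass (q : ℕ → ℝ) (S : Set ℕ) (n : ℕ) : ℝ :=
  ∑' i, S.indicator (fun i => q i * (1 - q i) ^ n) i

section Distinct

variable {ι : Type*}

lemma distinctCount_congr (S : Set ℕ) {I : Finset ι} {r r' : ι → ℕ} (h : ∀ k ∈ I, r k = r' k) :
    distinctCount S I r = distinctCount S I r' := by
  classical
  have himage : I.image r = I.image r' := Finset.image_congr fun k hk => h k hk
  unfold distinctCount
  congr! 2

lemma distinctCount_le (S : Set ℕ) (I : Finset ι) (r : ι → ℕ) :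
    distinctCount S I r ≤ I.card := by
  classical
  exact (Finset.card_filter_le _ _).trans Finset.card_image_le

/-- Removing the value `r k` from the set makes the remaining count independent of whether this
value recurs; this is the recursion behind the generating function bound. -/
lemma distinctCount_insert [DecidableEq ι] (S : Set ℕ) (k : ι) (I : Finset ι) (r : ι → ℕ)
    [Decidable (r k ∈ S)] :
    distinctCount S (insert k I) r =
      if r k ∈ S then distinctCount (S \ {r k}) I r + 1 else distinctCount S I r := by
  classical
  unfold distinctCount
  rw [Finset.image_insert, Finset.filter_insert]
  split_ifs with h
  · refine (congrArg Finset.card ?_).trans (Finset.card_insert_of_notMem (a := r k) (by simp))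
    ext j
    simp only [Finset.mem_filter, Finset.mem_insert, Set.mem_sdiff, Set.mem_singleton_iff]
    by_cases hj : j = r k
    · simp [hj]
    · simp [hj]
  · rfl

open Classical in
/-- `distinctCount` as a function of the restriction of the sequence to the index set. -/
lemma distinctCount_restrict (S : Set ℕ) (I : Finset ι) (r : ι → ℕ) :
    distinctCount S I (fun k => if h : k ∈ I then I.restrict r ⟨k, h⟩ else 0) =
      distinctCount S I r :=
  distinctCount_congr S fun k hk => by simp [hk]

lemma measurable_distinctCount (S : Set ℕ) (I : Finset ι) :
    Measurable (distinctCount S I : (ι → ℕ) → ℕ) := by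
  classical
  have h : (distinctCount S I : (ι → ℕ) → ℕ) =
      (fun f : I → ℕ => distinctCount S I (fun k => if h : k ∈ I then f ⟨k, h⟩ else 0)) ∘
        I.restrict := by
    ext r; exact (distinctCount_restrict S I r).symm
  rw [h]
  exact (Measurable.of_discrete).comp (Finset.measurable_restrict I)

end Distinct

/-- By convexity `exp (a * (1 - z))` lies below its chord on [0, 1], and z e^(1-z) ≤ 1. It holds on
both sides of z = 1, so both tails are served. -/
lemma mul_exp_neg_le {z a : ℝ} (hz : 0 < z) (ha : 0 ≤ a) (ha1 : a ≤ 1) :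
    z * Real.exp (-((z - 1) * a)) ≤ 1 + (z - 1) * (1 - a) := by
  have hconv := convexOn_exp.2 (Set.mem_univ (0 : ℝ)) (Set.mem_univ (1 - z))
    (sub_nonneg.2 ha1) ha (by ring)
  have h1 : z * Real.exp (1 - z) ≤ 1 := by
    have := Real.add_one_le_exp (z - 1)
    rw [show 1 - z = -(z - 1) by ring, Real.exp_neg, ← div_eq_mul_inv, div_le_one (Real.exp_pos _)]
    linarith
  simp only [smul_eq_mul, mul_zero, zero_add, Real.exp_zero, mul_one] at hconv
  rw [show -((z - 1) * a) = a * (1 - z) by ring]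
  nlinarith [mul_le_mul_of_nonneg_left hconv hz.le, mul_le_mul_of_nonneg_left h1 ha]

section Sums

variable {q : ℕ → ℝ} (hq0 : ∀ i, 0 ≤ q i) (hq1 : ∀ i, q i ≤ 1) (hqs : Summable q)
include hq0 hq1

lemma one_sub_pow_mem (i n : ℕ) : 0 ≤ (1 - q i) ^ n ∧ (1 - q i) ^ n ≤ 1 :=
  ⟨pow_nonneg (by linarith [hq1 i]) n, pow_le_one₀ (by linarith [hq1 i]) (by linarith [hq0 i])⟩

include hqs

lemma summable_expectedDistinct (S : Set ℕ) (n : ℕ) :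
    Summable (S.indicator (fun i => 1 - (1 - q i) ^ n)) := by
  refine Summable.indicator ?_ S
  refine Summable.of_nonneg_of_le (fun i => by linarith [(one_sub_pow_mem hq0 hq1 i n).2])
    (fun i => ?_) (hqs.mul_left (n : ℝ))
  have := one_add_mul_le_pow (a := -q i) (by linarith [hq1 i]) n
  rw [← sub_eq_add_neg] at this
  linarith

lemma summable_unseenMass (S : Set ℕ) (n : ℕ) :
    Summable (S.indicator (fun i => q i * (1 - q i) ^ n)) := by
  refine Summable.indicator ?_ S
  exact Summable.of_nonneg_of_le
    (fun i => mul_nonneg (hq0 i) (one_sub_pow_mem hq0 hq1 i n).1)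
    (fun i => mul_le_of_le_one_right (hq0 i) (one_sub_pow_mem hq0 hq1 i n).2) hqs

/-- One more draw adds a distinct element exactly when it falls on an unseen element of `S`. -/
lemma expectedDistinct_succ (S : Set ℕ) (n : ℕ) :
    expectedDistinct q S (n + 1) = expectedDistinct q S n + unseenMass q S n := by
  unfold expectedDistinct unseenMass
  rw [← (summable_expectedDistinct hq0 hq1 hqs S n).tsum_add
    (summable_unseenMass hq0 hq1 hqs S n)]
  congr 1; ext i
  by_cases hi : i ∈ S
  · simp only [hi, Set.indicator_of_mem]; ring
  · simp [hi]

lemma expectedDistinct_diff_singleton {S : Set ℕ} {j : ℕ} (hj : j ∈ S) (n : ℕ) :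
    expectedDistinct q (S \ {j}) n = expectedDistinct q S n - (1 - (1 - q j) ^ n) := by
  unfold expectedDistinct
  rw [(summable_expectedDistinct hq0 hq1 hqs S n).tsum_eq_add_tsum_ite j,
    Set.indicator_of_mem hj, add_sub_cancel_left]
  congr 1; ext i
  by_cases hi : i = j
  · simp [hi]
  · by_cases hiS : i ∈ S <;> simp [hi, hiS]

end Sums

/-! ### Chernoff bounds and unseen mass for independent draws -/

section Draws

variable {Ω : Type*} [MeasurableSpace Ω] {P : Measure Ω} [IsProbabilityMeasure P]
  {ι : Type*} {R : ι → Ω → ℕ} {q : ℕ → ℝ}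

omit [IsProbabilityMeasure P] in
lemma hasSum_measureReal_iUnion [IsFiniteMeasure P] {s : ℕ → Set Ω}
    (hs : ∀ i, MeasurableSet (s i)) (hd : Pairwise (Function.onFun Disjoint s)) :
    HasSum (fun i => P.real (s i)) (P.real (⋃ i, s i)) := by
  have h := measure_iUnion (μ := P) hd hs
  have hne : ∑' i, P (s i) ≠ ⊤ := h ▸ measure_ne_top P _
  simp only [measureReal_def]
  rw [h, ENNReal.tsum_toReal_eq fun i => measure_ne_top P _]
  exact (ENNReal.summable_toReal hne).hasSum

lemma hasSum_law {X : Ω → ℕ} (hX : Measurable X) (hlaw : ∀ i, P.real {ω | X ω = i} = q i) :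
    HasSum q 1 := by
  have h := hasSum_measureReal_iUnion (P := P) (s := fun i => {ω | X ω = i})
    (fun i => hX (measurableSet_singleton i))
    (fun i j hij => Set.disjoint_left.2 fun ω h1 h2 => hij (h1.symm.trans h2))
  have hu : (⋃ i, {ω | X ω = i}) = Set.univ := by ext ω; simp
  simpa only [hlaw, hu, probReal_univ] using h

omit [IsProbabilityMeasure P] in
lemma integral_comp_law {X : Ω → ℕ} (hX : Measurable X)
    (hlaw : ∀ i, P.real {ω | X ω = i} = q i) {f : ℕ → ℝ} (hf : Integrable f (P.map X)) :
    ∫ j, f j ∂(P.map X) = ∑' i, q i * f i := by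
  rw [integral_countable hf]
  congr 1; ext i
  rw [map_measureReal_apply hX (measurableSet_singleton i), ← hlaw i]
  rfl

lemma integrable_of_bounded {α : Type*} [MeasurableSpace α] {m : Measure α} [IsFiniteMeasure m]
    {f : α → ℝ} (hf : Measurable f) (C : ℝ) (h : ∀ x, |f x| ≤ C) : Integrable f m :=
  Integrable.of_bound hf.aestronglyMeasurable C (Eventually.of_forall h)

lemma pow_le_max_one_pow {z : ℝ} (hz : 0 < z) {k n : ℕ} (hkn : k ≤ n) :
    |z ^ k| ≤ (max 1 z) ^ n := by
  rw [abs_of_nonneg (by positivity)]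
  exact (pow_le_pow_left₀ hz.le (le_max_right 1 z) k).trans
    (pow_le_pow_right₀ (le_max_left 1 z) hkn)

/-- Negative dependence of the occupancy indicators: the generating function of the number of
distinct elements is at most that of a Poisson variable with the same mean. -/
theorem integral_pow_distinctCount_le (hRmeas : ∀ k, Measurable (R k)) (hRindep : iIndepFun R P)
    (hRlaw : ∀ k i, P.real {ω | R k ω = i} = q i) {z : ℝ} (hz : 0 < z) (I : Finset ι) :
    ∀ S : Set ℕ, ∫ ω, z ^ distinctCount S I (fun k => R k ω) ∂P ≤
      Real.exp ((z - 1) * expectedDistinct q S I.card) := by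
  classical
  induction I using Finset.induction_on with
  | empty => intro S; simp [distinctCount, expectedDistinct]
  | insert k I hk ih =>
    intro S
    have hqs : Summable q := (hasSum_law (hRmeas k) (hRlaw k)).summable
    have hq0 : ∀ i, 0 ≤ q i := fun i => hRlaw k i ▸ measureReal_nonneg
    have hq1 : ∀ i, q i ≤ 1 := fun i => hRlaw k i ▸ measureReal_le_one
    have hp : IsProbabilityMeasure (P.map (R k)) :=
      Measure.isProbabilityMeasure_map (hRmeas k).aemeasurable
    have hVm : Measurable (fun ω => I.restrict (fun k => R k ω)) := by
      exact (Finset.measurable_restrict I).comp (measurable_pi_lambda _ hRmeas)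
    have hp' : IsProbabilityMeasure (P.map (fun ω => I.restrict (fun k => R k ω))) :=
      Measure.isProbabilityMeasure_map hVm.aemeasurable
    have hind : IndepFun (R k) (fun ω => I.restrict (fun k => R k ω)) P := by
      have h := hRindep.indepFun_finset {k} I (by simpa using hk) hRmeas
      exact h.comp (φ := fun f : ({k} : Finset ι) → ℕ => f ⟨k, by simp⟩) (ψ := id)
        (measurable_pi_apply _) measurable_id
    let D : Set ℕ → (I → ℕ) → ℕ := fun T f =>
      distinctCount T I (fun k => if h : k ∈ I then f ⟨k, h⟩ else 0)
    have hD : ∀ T r, D T (I.restrict r) = distinctCount T I r := fun T r =>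
      distinctCount_restrict T I r
    -- The integrand with the draw `R k` separated from the others: a value in `S` contributes a
    -- factor z and is removed from `S`.
    let G : ℕ × (I → ℕ) → ℝ := fun p =>
      if p.1 ∈ S then z * z ^ D (S \ {p.1}) p.2 else z ^ D S p.2
    have hGm : Measurable G := Measurable.of_discrete
    have hGb : ∀ p, |G p| ≤ (max 1 z) ^ (I.card + 1) := by
      intro p
      simp only [G]
      split_ifs
      · rw [← pow_succ']
        exact pow_le_max_one_pow hz (Nat.add_le_add_right (distinctCount_le _ _ _) 1)
      · exact pow_le_max_one_pow hz ((distinctCount_le _ _ _).trans (Nat.le_succ _))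
    set n := I.card with hn
    set M := expectedDistinct q S n with hM
    -- Bound for the conditional expectation given that the draw `R k` equals j.
    let g : ℕ → ℝ := fun j => Real.exp ((z - 1) * M) *
      (1 + S.indicator (fun j => (z - 1) * (1 - q j) ^ n) j)
    have hgi : Integrable g (P.map (R k)) := by
      refine integrable_of_bounded Measurable.of_discrete
        (Real.exp ((z - 1) * M) * (1 + |z - 1|)) fun j => ?_
      simp only [g, abs_mul, Real.abs_exp]
      gcongr
      refine (abs_add_le _ _).trans ?_
      rw [abs_one]
      refine add_le_add_right ?_ 1
      by_cases hj : j ∈ S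
      · obtain ⟨h0, h1⟩ := one_sub_pow_mem hq0 hq1 j n
        rw [Set.indicator_of_mem hj, abs_mul, abs_of_nonneg h0]
        exact mul_le_of_le_one_right (abs_nonneg _) h1
      · simp [hj]
    calc ∫ ω, z ^ distinctCount S (insert k I) (fun k => R k ω) ∂P
        = ∫ ω, G (R k ω, I.restrict (fun k => R k ω)) ∂P := by
          congr 1; ext ω
          rw [distinctCount_insert]
          simp only [G, hD]
          split_ifs
          · rw [pow_succ']
          · rfl
      _ = ∫ p, G p ∂((P.map (R k)).prod (P.map (fun ω => I.restrict (fun k => R k ω)))) := by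
          rw [← (indepFun_iff_map_prod_eq_prod_map_map (hRmeas k).aemeasurable
            hVm.aemeasurable).1 hind, integral_map ((hRmeas k).prodMk hVm).aemeasurable
            hGm.aestronglyMeasurable]
      _ = ∫ j, ∫ f, G (j, f) ∂(P.map (fun ω => I.restrict (fun k => R k ω))) ∂(P.map (R k)) :=
          integral_prod _ (integrable_of_bounded hGm _ hGb)
      _ ≤ ∫ j, g j ∂(P.map (R k)) := by
          refine integral_mono (integrable_of_bounded Measurable.of_discrete
            ((max 1 z) ^ (I.card + 1)) fun j => ?_) hgi fun j => ?_
          · refine (norm_integral_le_of_norm_le_const (C := (max 1 z) ^ (I.card + 1))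
              (Eventually.of_forall fun f =>
                (Real.norm_eq_abs _).trans_le (hGb (j, f)))).trans ?_
            simp
          · simp only
            rw [integral_map hVm.aemeasurable Measurable.of_discrete.aestronglyMeasurable]
            simp only [G, hD, g]
            by_cases hj : j ∈ S
            · obtain ⟨h0, h1⟩ := one_sub_pow_mem hq0 hq1 j n
              simp only [hj, if_true, Set.indicator_of_mem]
              rw [integral_const_mul]
              -- The induction hypothesis is needed for the smaller set `S \ {j}`, which is why the
              -- induction runs over all `S`.
              calc _ ≤ z * Real.exp ((z - 1) * expectedDistinct q (S \ {j}) n) :=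
                    mul_le_mul_of_nonneg_left (ih _) hz.le
                _ = Real.exp ((z - 1) * M) *
                    (z * Real.exp (-((z - 1) * (1 - (1 - q j) ^ n)))) := by
                    rw [expectedDistinct_diff_singleton hq0 hq1 hqs hj, mul_sub,
                      sub_eq_add_neg, Real.exp_add]
                    ring
                _ ≤ _ := by
                    gcongr
                    refine (mul_exp_neg_le hz (by linarith) (by linarith)).trans_eq ?_
                    ring
            · simp only [hj, if_false, Set.indicator_of_notMem, not_false_eq_true, add_zero,
                mul_one]
              exact ih S
      _ = Real.exp ((z - 1) * M) * (1 + (z - 1) * unseenMass q S n) := by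
          rw [integral_comp_law (hRmeas k) (hRlaw k) hgi]
          have h1 : ∀ i, q i * g i = Real.exp ((z - 1) * M) *
              (q i + (z - 1) * S.indicator (fun i => q i * (1 - q i) ^ n) i) := by
            intro i
            by_cases hi : i ∈ S
            · simp only [g, hi, Set.indicator_of_mem]; ring
            · simp only [g, hi, Set.indicator_of_notMem, not_false_eq_true]; ring
          simp_rw [h1]
          rw [tsum_mul_left, (hqs.tsum_add ((summable_unseenMass hq0 hq1 hqs S n).mul_left _)),
            tsum_mul_left, (hasSum_law (hRmeas k) (hRlaw k)).tsum_eq]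
          rfl
      _ ≤ Real.exp ((z - 1) * M) * Real.exp ((z - 1) * unseenMass q S n) := by
          gcongr
          linarith [Real.add_one_le_exp ((z - 1) * unseenMass q S n)]
      _ = _ := by
          rw [Finset.card_insert_of_notMem hk, expectedDistinct_succ hq0 hq1 hqs, mul_add,
            Real.exp_add]

/-- Chernoff bound for the number of distinct elements. -/
theorem measureReal_distinctCount_le (hRmeas : ∀ k, Measurable (R k)) (hRindep : iIndepFun R P)
    (hRlaw : ∀ k i, P.real {ω | R k ω = i} = q i) {z : ℝ} (hz : 0 < z) (I : Finset ι)
    (S : Set ℕ) (x : ℝ) {A : Set Ω}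
    (hA : ∀ ω ∈ A, z ^ x ≤ z ^ distinctCount S I (fun k => R k ω)) :
    P.real A ≤ Real.exp (-(x * Real.log z) + (z - 1) * expectedDistinct q S I.card) := by
  have hint : Integrable (fun ω => z ^ distinctCount S I (fun k => R k ω)) P :=
    integrable_of_bounded ((Measurable.of_discrete (f := fun n : ℕ => z ^ n)).comp
      ((measurable_distinctCount S I).comp (measurable_pi_lambda _ hRmeas))) _
      fun ω => pow_le_max_one_pow hz (distinctCount_le S I _)
  have h := mul_meas_ge_le_integral_of_nonneg
    (Eventually.of_forall fun ω => by positivity) hint (z ^ x)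
  -- `hA` covers the upper tail when z ≥ 1 and the lower tail when z ≤ 1.
  have h1 : P.real A ≤ P.real {ω | z ^ x ≤ z ^ distinctCount S I (fun k => R k ω)} :=
    measureReal_mono hA
  have h2 := integral_pow_distinctCount_le hRmeas hRindep hRlaw hz I S
  have hzx : 0 < z ^ x := Real.rpow_pos_of_pos hz x
  have h3 : z ^ x = Real.exp (x * Real.log z) := by rw [Real.rpow_def_of_pos hz, mul_comm]
  rw [Real.exp_add, Real.exp_neg, ← h3, ← div_eq_inv_mul, le_div_iff₀' hzx]
  exact ((mul_le_mul_of_nonneg_left h1 hzx.le).trans h).trans h2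

theorem measureReal_unseen (hRmeas : ∀ k, Measurable (R k)) (hRindep : iIndepFun R P)
    (hRlaw : ∀ k i, P.real {ω | R k ω = i} = q i) (S : Set ℕ) {k : ι} {I : Finset ι}
    (hk : k ∉ I) :
    P.real {ω | R k ω ∈ S ∧ ∀ l ∈ I, R l ω ≠ R k ω} = unseenMass q S I.card := by
  classical
  have hq : ∀ i, P.real {ω | R k ω = i ∧ ∀ l ∈ I, R l ω ≠ i} = q i * (1 - q i) ^ I.card := by
    intro i
    have h := hRindep.measure_inter_preimage_eq_mul (insert k I)
      (sets := fun l => if l = k then {i} else {i}ᶜ) (fun l _ => MeasurableSet.of_discrete)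
    have hset : {ω | R k ω = i ∧ ∀ l ∈ I, R l ω ≠ i} =
        ⋂ l ∈ insert k I, R l ⁻¹' (if l = k then {i} else {i}ᶜ) := by
      ext ω
      simp only [Set.mem_ofPred_eq, Finset.mem_insert, Set.mem_iInter, Set.mem_preimage,
        forall_eq_or_imp, if_true, Set.mem_singleton_iff]
      refine and_congr_right fun _ => forall₂_congr fun l hl => ?_
      rw [if_neg (ne_of_mem_of_not_mem hl hk)]
      rfl
    rw [hset, measureReal_def, h, Finset.prod_insert hk, if_pos rfl, ENNReal.toReal_mul,
      ENNReal.toReal_prod, ← Finset.prod_const]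
    congr 1
    · exact hRlaw k i
    · refine Finset.prod_congr rfl fun l hl => ?_
      rw [if_neg (ne_of_mem_of_not_mem hl hk), Set.preimage_compl, ← hRlaw l i, ← measureReal_def,
        probReal_compl_eq_one_sub (hRmeas l (measurableSet_singleton i))]
      rfl
  have hset : {ω | R k ω ∈ S ∧ ∀ l ∈ I, R l ω ≠ R k ω} =
      ⋃ i, {ω | i ∈ S ∧ R k ω = i ∧ ∀ l ∈ I, R l ω ≠ i} := by
    ext ω; simp
  have hm : ∀ i, MeasurableSet {ω | i ∈ S ∧ R k ω = i ∧ ∀ l ∈ I, R l ω ≠ i} := by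
    intro i
    have hall : {ω | ∀ l ∈ I, R l ω ≠ i} = ⋂ l ∈ I, R l ⁻¹' {i}ᶜ := by ext ω; simp
    refine (MeasurableSet.const (i ∈ S)).inter
      (MeasurableSet.inter (s₁ := {ω | R k ω = i}) (hRmeas k (measurableSet_singleton i))
        (s₂ := {ω | ∀ l ∈ I, R l ω ≠ i}) ?_)
    rw [hall]
    exact Finset.measurableSet_biInter I fun l _ => hRmeas l (measurableSet_singleton i).compl
  have h := hasSum_measureReal_iUnion (P := P) hm
    (fun i j hij => Set.disjoint_left.2 fun ω h1 h2 => hij (h1.2.1.symm.trans h2.2.1))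
  rw [hset, ← h.tsum_eq, unseenMass]
  congr 1; ext i
  by_cases hi : i ∈ S
  · simp only [hi, true_and, hq, Set.indicator_of_mem]
  · simp [hi]

end Draws

/-! ### Level counts and the layer-cake formula -/

open Set Topology

/-- The number of items whose popularity exceeds `t`, for antitone popularities `q` tending to
zero. -/
noncomputable def levelIndex (q : ℕ → ℝ) (t : ℝ) : ℕ := sInf {i | q i ≤ t}

open Classical in
/-- The number of items in `S` whose popularity exceeds `t`. -/
noncomputable def levelCount (q : ℕ → ℝ) (S : Set ℕ) (t : ℝ) : ℝ :=
  (Nat.count (· ∈ S) (levelIndex q t) : ℝ)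

section Level

variable {q : ℕ → ℝ}

/-- Monotonicity makes the items above level t an initial segment; since `q` tends to zero and t >
0, the infimum is over a nonempty set and is not the default value. -/
lemma lt_levelIndex_iff (hq : Antitone q) (hq0 : Tendsto q atTop (𝓝 0)) {t : ℝ} (ht : 0 < t)
    (i : ℕ) : i < levelIndex q t ↔ t < q i := by
  have hne : {i | q i ≤ t}.Nonempty := ((hq0.eventually (ge_mem_nhds ht)).exists)
  constructor
  · intro h
    exact not_le.1 (Nat.notMem_of_lt_sInf h)
  · intro h
    by_contra hi
    exact absurd ((hq (not_lt.1 hi)).trans (Nat.sInf_mem hne)) (not_le.2 h)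

lemma tendsto_levelIndex (hq : Antitone q) (hq0 : Tendsto q atTop (𝓝 0)) (hpos : ∀ i, 0 < q i) :
    Tendsto (levelIndex q) (𝓝[>] 0) atTop := by
  refine tendsto_atTop.2 fun k => ?_
  filter_upwards [self_mem_nhdsWithin, nhdsWithin_le_nhds (Iio_mem_nhds (hpos k))] with t ht htk
  exact ((lt_levelIndex_iff hq hq0 ht k).2 htk).le

lemma levelCount_le_levelIndex (S : Set ℕ) (t : ℝ) : levelCount q S t ≤ levelIndex q t := by
  classical
  exact Nat.cast_le.2 (Nat.count_le _)

lemma levelCount_nonneg (S : Set ℕ) (t : ℝ) : 0 ≤ levelCount q S t := Nat.cast_nonneg _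

lemma antitoneOn_levelCount (hq : Antitone q) (hq0 : Tendsto q atTop (𝓝 0)) (S : Set ℕ) :
    AntitoneOn (levelCount q S) (Ioi 0) := by
  classical
  intro s hs t ht hst
  unfold levelCount
  refine Nat.cast_le.2 (Nat.count_monotone _ ?_)
  by_contra! h
  have h1 := (lt_levelIndex_iff hq hq0 ht _).1 h
  exact lt_irrefl _ ((lt_levelIndex_iff hq hq0 hs _).2 (hst.trans_lt h1))

lemma hasSum_levelCount (hq : Antitone q) (hq0 : Tendsto q atTop (𝓝 0)) (S : Set ℕ) {t : ℝ}
    (ht : 0 < t) :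
    HasSum (S.indicator fun i => (Iio (q i)).indicator (fun _ => (1 : ℝ)) t) (levelCount q S t) := by
  classical
  have h : levelCount q S t = ∑ i ∈ Finset.range (levelIndex q t),
      S.indicator (fun i => (Iio (q i)).indicator (fun _ => (1 : ℝ)) t) i := by
    rw [levelCount, Nat.count_eq_card_filter_range, Finset.card_filter, Nat.cast_sum]
    refine Finset.sum_congr rfl fun i hi => ?_
    have := (lt_levelIndex_iff hq hq0 ht i).1 (Finset.mem_range.1 hi)
    by_cases hiS : i ∈ S <;> simp [hiS, this]
  rw [h]
  refine hasSum_sum_of_ne_finset_zero fun i hi => ?_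
  have : ¬ t < q i := fun h => hi (Finset.mem_range.2 ((lt_levelIndex_iff hq hq0 ht i).2 h))
  by_cases hiS : i ∈ S <;> simp [hiS, this]

lemma levelCount_eq_zero (hq : Antitone q) (hq0 : Tendsto q atTop (𝓝 0)) (S : Set ℕ) {t : ℝ}
    (ht : 0 < t) (h : q 0 ≤ t) : levelCount q S t = 0 := by
  have : levelIndex q t = 0 := by
    by_contra hne
    exact absurd ((lt_levelIndex_iff hq hq0 ht 0).1 (Nat.pos_of_ne_zero hne)) (not_lt.2 h)
  simp [levelCount, this]

end Level

section LayerCake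

lemma hasDerivAt_one_sub_pow (n : ℕ) (t : ℝ) :
    HasDerivAt (fun t : ℝ => (1 - t) ^ n) (-(n * (1 - t) ^ (n - 1))) t := by
  simpa using! ((hasDerivAt_id t).const_sub 1).pow n

variable {q : ℕ → ℝ} (hq : Antitone q) (hpos : ∀ i, 0 < q i) (hq1 : ∀ i, q i ≤ 1)
  (hqs : Summable q)
include hq hpos hq1 hqs

/-- Write g(q_i) as the integral of g' over (0, q_i) and exchange sum and integral, which the
summable bound C q_i permits; the indicators of t < q_i over `S` add up to the level count. -/
lemma tsum_indicator_eq_integral_levelCount (S : Set ℕ) {g g' : ℝ → ℝ} (C : ℝ)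
    (hg : ∀ t, HasDerivAt g (g' t) t) (hg0 : g 0 = 0) (hg' : Continuous g')
    (hC : ∀ t, 0 ≤ t → t ≤ 1 → |g' t| ≤ C) :
    ∑' i, S.indicator (fun i => g (q i)) i = ∫ t in Ioi 0, g' t * levelCount q S t := by
  have hq0 := hqs.tendsto_atTop_zero
  let f : ℕ → ℝ → ℝ := fun i t => S.indicator (fun i => (Iio (q i)).indicator g' t) i
  have hfi : ∀ i, IntegrableOn ((Iio (q i)).indicator g') (Ioi 0) := by
    intro i
    rw [integrableOn_indicator_iff measurableSet_Iio, inter_comm, Ioi_inter_Iio]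
    exact (hg'.integrableOn_Icc (a := 0) (b := q i)).mono_set Ioo_subset_Icc_self
  have hint : ∀ i, Integrable (f i) (volume.restrict (Ioi 0)) := by
    intro i
    by_cases hi : i ∈ S
    · simpa only [f, hi, indicator_of_mem] using! hfi i
    · simp [f, hi]
  have hval : ∀ i, ∫ t in Ioi 0, f i t = S.indicator (fun i => g (q i)) i := by
    intro i
    by_cases hi : i ∈ S
    · simp only [f, hi, indicator_of_mem]
      rw [setIntegral_indicator measurableSet_Iio, Ioi_inter_Iio, ← integral_Ioc_eq_integral_Ioo,
        ← intervalIntegral.integral_of_le (hpos i).le,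
        intervalIntegral.integral_eq_sub_of_hasDerivAt (fun t _ => hg t)
          (hg'.intervalIntegrable _ _), hg0, sub_zero]
    · simp [f, hi]
  have hnorm : ∀ i, ∫ t in Ioi 0, ‖f i t‖ ≤ C * q i := by
    intro i
    have hCn : 0 ≤ C := (abs_nonneg _).trans (hC 0 le_rfl zero_le_one)
    by_cases hi : i ∈ S
    · have h1 : ∀ t, ‖f i t‖ = (Iio (q i)).indicator (fun t => ‖g' t‖) t := by
        intro t
        simp only [f, hi, indicator_of_mem]
        exact norm_indicator_eq_indicator_norm _ _
      simp_rw [h1]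
      rw [setIntegral_indicator measurableSet_Iio, Ioi_inter_Iio]
      refine (le_abs_self _).trans ?_
      rw [← Real.norm_eq_abs]
      refine (norm_setIntegral_le_of_norm_le_const (C := C) (by simp) ?_).trans_eq ?_
      · intro t ht
        simpa using hC t ht.1.le (ht.2.le.trans (hq1 i))
      · simp [(hpos i).le]
    · simpa [f, hi] using mul_nonneg hCn (hpos i).le
  have key := integral_tsum_of_summable_integral_norm hint
    (Summable.of_nonneg_of_le (fun i => by positivity) hnorm (hqs.mul_left C))
  simp_rw [hval] at key
  rw [key]
  refine setIntegral_congr_fun measurableSet_Ioi fun t ht => ?_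
  have h := (hasSum_levelCount hq hq0 S ht).mul_left (g' t)
  rw [← h.tsum_eq]
  refine tsum_congr fun i => ?_
  by_cases hi : i ∈ S
  · by_cases hti : t < q i <;> simp [f, hi, hti]
  · simp [f, hi]

lemma expectedDistinct_eq_integral (S : Set ℕ) (n : ℕ) :
    expectedDistinct q S n = ∫ t in Ioi 0, n * (1 - t) ^ (n - 1) * levelCount q S t := by
  refine tsum_indicator_eq_integral_levelCount hq hpos hq1 hqs S (g := fun t => 1 - (1 - t) ^ n)
    n (fun t => ?_) (by simp) (by fun_prop) fun t h0 h1 => ?_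
  · simpa using (hasDerivAt_one_sub_pow n t).const_sub 1
  · have h2 := pow_le_one₀ (n := n - 1) (sub_nonneg.2 h1) (by linarith)
    rw [abs_of_nonneg (mul_nonneg n.cast_nonneg (pow_nonneg (sub_nonneg.2 h1) _))]
    exact mul_le_of_le_one_right n.cast_nonneg h2

lemma unseenMass_eq_integral (S : Set ℕ) (n : ℕ) :
    unseenMass q S n =
      ∫ t in Ioi 0, ((1 - t) ^ n - n * t * (1 - t) ^ (n - 1)) * levelCount q S t := by
  refine tsum_indicator_eq_integral_levelCount hq hpos hq1 hqs S (g := fun t => t * (1 - t) ^ n)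
    (1 + n) (fun t => ?_) (by simp) (by fun_prop) fun t h0 h1 => ?_
  · refine ((hasDerivAt_id t).mul (hasDerivAt_one_sub_pow n t)).congr_deriv ?_
    simp only [id]; ring
  · have h2 := pow_le_one₀ (n := n - 1) (sub_nonneg.2 h1) (by linarith)
    have h3 := pow_le_one₀ (n := n) (sub_nonneg.2 h1) (by linarith)
    have h4 := pow_nonneg (sub_nonneg.2 h1) n
    have h5 := pow_nonneg (sub_nonneg.2 h1) (n - 1)
    refine (abs_sub _ _).trans (add_le_add ?_ ?_)
    · rwa [abs_of_nonneg h4]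
    · rw [abs_of_nonneg (by positivity), mul_assoc]
      exact mul_le_of_le_one_right n.cast_nonneg (mul_le_one₀ h1 h5 h2)

end LayerCake

/-! ### Level counts under a Zipf law and the Abelian theorem -/

section Zipf

variable {q : ℕ → ℝ} {c α : ℝ} (hc : 0 < c)
  (hZipf : q ~[atTop] fun i => c / ((i : ℝ) + 1) ^ α)
include hc hZipf

lemma tendsto_mul_succ_rpow : Tendsto (fun k => q k * ((k : ℝ) + 1) ^ α) atTop (𝓝 c) := by
  have hne : ∀ᶠ k : ℕ in atTop, c / ((k : ℝ) + 1) ^ α ≠ 0 :=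
    Eventually.of_forall fun k => by positivity
  have h := ((isEquivalent_iff_tendsto_one hne).1 hZipf).mul_const c
  rw [one_mul] at h
  refine h.congr fun k => ?_
  have : ((k : ℝ) + 1) ^ α ≠ 0 := by positivity
  simp only [Pi.div_apply]
  field_simp

lemma pos_of_zipf (hq : Antitone q) (i : ℕ) : 0 < q i := by
  obtain ⟨k, hk, hik⟩ := (((tendsto_mul_succ_rpow hc hZipf).eventually (lt_mem_nhds hc)).and
    (eventually_ge_atTop i)).exists
  exact (pos_of_mul_pos_left hk (by positivity)).trans_le (hq hik)

lemma tendsto_mul_rpow : Tendsto (fun k => q k * (k : ℝ) ^ α) atTop (𝓝 c) := by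
  have h1 : Tendsto (fun k : ℕ => (k : ℝ) / ((k : ℝ) + 1)) atTop (𝓝 1) :=
    tendsto_natCast_div_add_atTop 1
  have h2 := (h1.rpow_const (p := α) (Or.inl one_ne_zero)).mul (tendsto_mul_succ_rpow hc hZipf)
  rw [Real.one_rpow, one_mul] at h2
  refine h2.congr fun k => ?_
  rw [Real.div_rpow (by positivity) (by positivity)]
  have : ((k : ℝ) + 1) ^ α ≠ 0 := by positivity
  field_simp

lemma tendsto_pred_mul_rpow : Tendsto (fun k => q (k - 1) * (k : ℝ) ^ α) atTop (𝓝 c) := by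
  refine ((tendsto_mul_succ_rpow hc hZipf).comp (tendsto_sub_atTop_nat 1)).congr' ?_
  filter_upwards [eventually_ge_atTop 1] with k hk
  simp [Nat.cast_sub hk]

variable (hα : 1 < α) (hq : Antitone q) (hq0 : Tendsto q atTop (𝓝 0))
include hα hq hq0

omit hα in
-- With L the level index, q_L ≤ t < q_(L-1), and both ends times L^α tend to c.
lemma tendsto_mul_levelIndex_rpow :
    Tendsto (fun t => t * (levelIndex q t : ℝ) ^ α) (𝓝[>] 0) (𝓝 c) := by
  have hL := tendsto_levelIndex hq hq0 (pos_of_zipf hc hZipf hq)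
  refine tendsto_of_tendsto_of_tendsto_of_le_of_le' ((tendsto_mul_rpow hc hZipf).comp hL)
    ((tendsto_pred_mul_rpow hc hZipf).comp hL) ?_ ?_
  · filter_upwards [self_mem_nhdsWithin] with t ht
    refine mul_le_mul_of_nonneg_right ?_ (by positivity)
    exact not_lt.1 ((lt_levelIndex_iff hq hq0 ht _).not.1 (lt_irrefl _))
  · filter_upwards [self_mem_nhdsWithin, hL.eventually_ge_atTop 1] with t ht h1
    refine mul_le_mul_of_nonneg_right ?_ (by positivity)
    exact ((lt_levelIndex_iff hq hq0 ht _).1 (by omega)).le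

/-- The asymptotics concern small t only; dominated convergence needs a bound for every t > 0. -/
lemma levelCount_bound (S : Set ℕ) :
    ∃ C, 0 ≤ C ∧ ∀ t, 0 < t → levelCount q S t ≤ C * t ^ (-(1 / α)) := by
  obtain ⟨C, hC⟩ := (tendsto_mul_succ_rpow hc hZipf).bddAbove_range
  have hC' : ∀ k : ℕ, q k * ((k : ℝ) + 1) ^ α ≤ C := fun k => hC ⟨k, rfl⟩
  have hC0 : 0 ≤ C := (mul_nonneg (pos_of_zipf hc hZipf hq 0).le (by positivity)).trans (hC' 0)
  refine ⟨C ^ (1 / α), by positivity, fun t ht => (levelCount_le_levelIndex S t).trans ?_⟩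
  rcases Nat.eq_zero_or_pos (levelIndex q t) with h | h
  · rw [h, Nat.cast_zero]; positivity
  · obtain ⟨k, hk⟩ : ∃ k, levelIndex q t = k + 1 := ⟨_, (Nat.succ_pred_eq_of_pos h).symm⟩
    have h1 : t * ((k : ℝ) + 1) ^ α ≤ C := (mul_le_mul_of_nonneg_right
      ((lt_levelIndex_iff hq hq0 ht k).1 (by omega)).le (by positivity)).trans (hC' k)
    have h2 := Real.rpow_le_rpow (by positivity) h1 (by positivity : 0 ≤ 1 / α)
    rw [Real.mul_rpow ht.le (by positivity), ← Real.rpow_mul (by positivity),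
      mul_one_div_cancel (by positivity), Real.rpow_one] at h2
    rw [hk, Real.rpow_neg ht.le, ← div_eq_mul_inv, le_div_iff₀' (by positivity)]
    exact_mod_cast h2

open Classical in
lemma tendsto_levelCount {S : Set ℕ} {μ : ℝ}
    (hS : Tendsto (fun n : ℕ => (Nat.count (· ∈ S) n : ℝ) / n) atTop (𝓝 μ)) :
    Tendsto (fun t => levelCount q S t * t ^ (1 / α)) (𝓝[>] 0) (𝓝 (μ * c ^ (1 / α))) := by
  have hL := tendsto_levelIndex hq hq0 (pos_of_zipf hc hZipf hq)
  have h1 := (tendsto_mul_levelIndex_rpow hc hZipf hq hq0).rpow_const (p := 1 / α)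
    (Or.inl hc.ne')
  refine ((hS.comp hL).mul h1).congr' ?_
  filter_upwards [self_mem_nhdsWithin, hL.eventually_ge_atTop 1] with t ht hL1
  have ht' : (0 : ℝ) < t := ht
  have hL' : (levelIndex q t : ℝ) ≠ 0 := by positivity
  rw [Real.mul_rpow ht'.le (by positivity), ← Real.rpow_mul (by positivity),
    mul_one_div_cancel (by positivity), Real.rpow_one]
  simp only [Function.comp, levelCount]
  field_simp

/-- An Abelian theorem: integrals of rescaled kernels against the level counts. -/
theorem tendsto_integral_kernel_levelCount (hq1 : q 0 ≤ 1) {S : Set ℕ} {μ : ℝ}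
    (hS : Tendsto (fun t => levelCount q S t * t ^ (1 / α)) (𝓝[>] 0) (𝓝 (μ * c ^ (1 / α))))
    {k : ℕ → ℝ → ℝ} {κ : ℝ → ℝ} (hk : ∀ n, Continuous (k n))
    (hlim : ∀ u, 0 < u → Tendsto (fun n => k n u) atTop (𝓝 (κ u)))
    (hbd : ∀ n : ℕ, 2 ≤ n → ∀ u : ℝ, 0 < u → u ≤ n → |k n u| ≤ (1 + u) * Real.exp (-(1 / 2) * u)) :
    Tendsto (fun n : ℕ => ∫ u in Ioi 0, k n u * levelCount q S (u / n) * (n : ℝ) ^ (-(1 / α))) atTop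
      (𝓝 (∫ u in Ioi 0, κ u * (μ * c ^ (1 / α) * u ^ (-(1 / α))))) := by
  obtain ⟨C, hC0, hC⟩ := levelCount_bound hc hZipf hα hq hq0 S
  have hα' : 1 / α < 1 := (div_lt_one (by linarith)).2 hα
  refine tendsto_integral_filter_of_dominated_convergence
    (fun u => (1 + u) * Real.exp (-(1 / 2) * u) * (C * u ^ (-(1 / α)))) ?_ ?_ ?_ ?_
  · filter_upwards [eventually_gt_atTop 0] with n hn
    have hn' : (0 : ℝ) < n := by exact_mod_cast hn
    have hm : AEMeasurable (fun u : ℝ => levelCount q S (u / n)) (volume.restrict (Ioi 0)) := by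
      refine aemeasurable_restrict_of_antitoneOn measurableSet_Ioi fun s hs t ht hst => ?_
      exact antitoneOn_levelCount hq hq0 S (div_pos hs hn') (div_pos ht hn') (by gcongr)
    exact (((hk n).measurable.aemeasurable.mul hm).mul_const _).aestronglyMeasurable
  · filter_upwards [eventually_ge_atTop 2] with n hn
    have hn' : (0 : ℝ) < n := by positivity
    refine (ae_restrict_iff' measurableSet_Ioi).2 (Eventually.of_forall fun u hu => ?_)
    have hu' : (0 : ℝ) < u := hu
    rcases le_or_gt u n with h | h
    · rw [mul_assoc, norm_mul, Real.norm_eq_abs, Real.norm_eq_abs,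
        abs_of_nonneg (mul_nonneg (levelCount_nonneg _ _) (by positivity))]
      refine mul_le_mul (hbd n hn u hu' h) ?_ (mul_nonneg (levelCount_nonneg _ _) (by positivity))
        (by positivity)
      refine (mul_le_mul_of_nonneg_right (hC _ (div_pos hu' hn')) (by positivity)).trans_eq ?_
      rw [mul_assoc, ← Real.mul_rpow (by positivity) (by positivity), div_mul_cancel₀ _ hn'.ne']
    -- For u > n the level u/n exceeds 1 ≥ q_0, so no item lies above it; hence the kernels need a
    -- bound only for u ≤ n.
    · rw [levelCount_eq_zero hq hq0 S (div_pos hu' hn')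
        (hq1.trans ((one_le_div hn').2 h.le)), mul_zero, zero_mul, norm_zero]
      positivity
  · have h1 := integrableOn_rpow_mul_exp_neg_mul_rpow (p := 1) (s := -(1 / α)) (b := 1 / 2)
      (by linarith) one_pos (by norm_num)
    have h2 := integrableOn_rpow_mul_exp_neg_mul_rpow (p := 1) (s := 1 - 1 / α) (b := 1 / 2)
      (by linarith) one_pos (by norm_num)
    refine ((h1.add h2).const_mul C).congr ?_
    refine (ae_restrict_iff' measurableSet_Ioi).2 (Eventually.of_forall fun u hu => ?_)
    have hu' : (0 : ℝ) < u := hu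
    simp only [Pi.add_apply, Real.rpow_one]
    rw [show 1 - 1 / α = 1 + -(1 / α) by ring, Real.rpow_add hu', Real.rpow_one]
    ring
  · refine (ae_restrict_iff' measurableSet_Ioi).2 (Eventually.of_forall fun u hu => ?_)
    have hu' : (0 : ℝ) < u := hu
    have h0 : Tendsto (fun n : ℕ => u / (n : ℝ)) atTop (𝓝[>] 0) := by
      refine tendsto_nhdsWithin_iff.2 ⟨tendsto_const_div_atTop_nhds_zero_nat u, ?_⟩
      filter_upwards [eventually_gt_atTop 0] with n hn
      have hn' : (0 : ℝ) < n := by exact_mod_cast hn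
      exact div_pos hu' hn'
    refine ((hlim u hu').mul ((hS.comp h0).mul_const (u ^ (-(1 / α))))).congr' ?_
    filter_upwards [eventually_gt_atTop 0] with n hn
    have hn' : (0 : ℝ) < n := by exact_mod_cast hn
    simp only [Function.comp]
    rw [mul_assoc, mul_assoc, Real.div_rpow hu'.le hn'.le, Real.rpow_neg hu'.le,
      Real.rpow_neg hn'.le]
    have := (Real.rpow_pos_of_pos hu' (1 / α)).ne'
    have := (Real.rpow_pos_of_pos hn' (1 / α)).ne'
    field_simp

end Zipf

section Kernels

lemma tendsto_one_sub_div_pow (u : ℝ) :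
    Tendsto (fun n : ℕ => (1 - u / n) ^ n) atTop (𝓝 (Real.exp (-u))) := by
  refine (Real.tendsto_one_add_div_pow_exp (-u)).congr fun n => ?_
  rw [neg_div, sub_eq_add_neg]

lemma tendsto_one_sub_div_pow_pred (u : ℝ) :
    Tendsto (fun n : ℕ => (1 - u / n) ^ (n - 1)) atTop (𝓝 (Real.exp (-u))) := by
  have h1 : Tendsto (fun n : ℕ => 1 - u / (n : ℝ)) atTop (𝓝 1) := by
    simpa using (tendsto_const_div_atTop_nhds_zero_nat u).const_sub 1
  have h2 := (tendsto_one_sub_div_pow u).div h1 one_ne_zero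
  rw [div_one] at h2
  refine h2.congr' ?_
  filter_upwards [eventually_ge_atTop 1, h1.eventually_ne one_ne_zero] with n hn hne
  simp only [Pi.div_apply]
  rw [div_eq_iff hne, ← pow_succ, Nat.sub_add_cancel hn]

/-- The rate 1/2 comes from (n - 1)/n ≥ 1/2. -/
lemma one_sub_div_pow_pred_le {n : ℕ} (hn : 2 ≤ n) {u : ℝ} (hu : 0 < u) (hun : u ≤ n) :
    (1 - u / n) ^ (n - 1) ≤ Real.exp (-(1 / 2) * u) := by
  have hn' : (0 : ℝ) < n := by positivity
  have h0 : 0 ≤ 1 - u / n := sub_nonneg.2 ((div_le_one hn').2 hun)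
  refine (pow_le_pow_left₀ h0 (Real.one_sub_le_exp_neg (u / n)) _).trans ?_
  rw [← Real.exp_nat_mul, Nat.cast_sub (by omega)]
  refine Real.exp_le_exp.2 ?_
  have h2 : (2 : ℝ) ≤ n := by exact_mod_cast hn
  have h3 : u / n * 2 ≤ u := by
    rw [div_mul_eq_mul_div, div_le_iff₀ hn']
    exact mul_le_mul_of_nonneg_left h2 hu.le
  have h4 : (n : ℝ) * (u / n) = u := mul_div_cancel₀ _ hn'.ne'
  push_cast
  nlinarith

end Kernels

/-! ### Growth of the expected distinct count and decay of the unseen mass -/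

section Asymptotics

variable {q : ℕ → ℝ} {c α μ : ℝ} {S : Set ℕ}

open Classical in
-- Substituting t = u/n in the layer-cake integral gives a kernel tending to e^(-u), whose integral
-- against u^(-1/α) is the Gamma value.
theorem tendsto_expectedDistinct (hc : 0 < c) (hα : 1 < α)
    (hZipf : q ~[atTop] fun i => c / ((i : ℝ) + 1) ^ α) (hq : Antitone q) (hq1 : ∀ i, q i ≤ 1)
    (hqs : Summable q)
    (hS : Tendsto (fun n : ℕ => (Nat.count (· ∈ S) n : ℝ) / n) atTop (𝓝 μ)) :
    Tendsto (fun n : ℕ => expectedDistinct q S n * (n : ℝ) ^ (-(1 / α))) atTop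
      (𝓝 (μ * c ^ (1 / α) * Real.Gamma (1 - 1 / α))) := by
  have hq0 := hqs.tendsto_atTop_zero
  have hα' : 1 / α < 1 := (div_lt_one (by linarith)).2 hα
  have h := tendsto_integral_kernel_levelCount hc hZipf hα hq hq0 (hq1 0)
    (tendsto_levelCount hc hZipf hα hq hq0 hS) (k := fun n (u : ℝ) => (1 - u / n) ^ (n - 1))
    (κ := fun u => Real.exp (-u)) (fun n => by fun_prop)
    (fun u _ => tendsto_one_sub_div_pow_pred u) (fun n hn u hu hun => ?_)
  · have hlim : ∫ u in Ioi 0, Real.exp (-u) * (μ * c ^ (1 / α) * u ^ (-(1 / α))) =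
        μ * c ^ (1 / α) * Real.Gamma (1 - 1 / α) := by
      rw [Real.Gamma_eq_integral (by linarith), ← integral_const_mul]
      congr 1; ext u
      rw [show 1 - 1 / α - 1 = -(1 / α) by ring]
      ring
    rw [hlim] at h
    refine h.congr' ?_
    filter_upwards [eventually_gt_atTop 0] with n hn
    have hn' : (0 : ℝ) < n := by exact_mod_cast hn
    rw [integral_mul_const, expectedDistinct_eq_integral hq (pos_of_zipf hc hZipf hq) hq1 hqs]
    congr 1
    have := integral_comp_mul_left_Ioi
      (fun t => n * (1 - t) ^ (n - 1) * levelCount q S t) 0 (inv_pos.2 hn')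
    rw [mul_zero, inv_inv, smul_eq_mul] at this
    rw [← mul_right_inj' hn'.ne', ← this, ← integral_const_mul]
    congr 1; ext u
    rw [div_eq_inv_mul]; ring
  · have hn' : (0 : ℝ) < n := by positivity
    have h0 : 0 ≤ 1 - u / n := sub_nonneg.2 ((div_le_one hn').2 hun)
    rw [abs_of_nonneg (pow_nonneg h0 _)]
    exact (one_sub_div_pow_pred_le hn hu hun).trans
      (le_mul_of_one_le_left (Real.exp_pos _).le (by linarith))

open Classical in
-- The limiting kernel is (1 - u) e^(-u). With s = 1 - 1/α its integral is Γ(s) - Γ(s + 1) = (1 - s)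
-- Γ(s), whence the factor 1/α.
theorem tendsto_unseenMass (hc : 0 < c) (hα : 1 < α)
    (hZipf : q ~[atTop] fun i => c / ((i : ℝ) + 1) ^ α) (hq : Antitone q) (hq1 : ∀ i, q i ≤ 1)
    (hqs : Summable q)
    (hS : Tendsto (fun n : ℕ => (Nat.count (· ∈ S) n : ℝ) / n) atTop (𝓝 μ)) :
    Tendsto (fun n : ℕ => unseenMass q S n * (n : ℝ) ^ (1 - 1 / α)) atTop
      (𝓝 (μ * c ^ (1 / α) * Real.Gamma (1 - 1 / α) / α)) := by
  have hq0 := hqs.tendsto_atTop_zero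
  have hα' : 1 / α < 1 := (div_lt_one (by linarith)).2 hα
  have h := tendsto_integral_kernel_levelCount hc hZipf hα hq hq0 (hq1 0)
    (tendsto_levelCount hc hZipf hα hq hq0 hS)
    (k := fun n (u : ℝ) => (1 - u / n) ^ n - u * (1 - u / n) ^ (n - 1))
    (κ := fun u => Real.exp (-u) - u * Real.exp (-u)) (fun n => by fun_prop)
    (fun u _ => (tendsto_one_sub_div_pow u).sub ((tendsto_one_sub_div_pow_pred u).const_mul u))
    (fun n hn u hu hun => ?_)
  · have hlim : ∫ u in Ioi 0, (Real.exp (-u) - u * Real.exp (-u)) *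
        (μ * c ^ (1 / α) * u ^ (-(1 / α))) =
        μ * c ^ (1 / α) * Real.Gamma (1 - 1 / α) / α := by
      have hs : 0 < 1 - 1 / α := by linarith
      have h1 : Real.Gamma (1 - 1 / α) / α =
          Real.Gamma (1 - 1 / α) - Real.Gamma (1 - 1 / α + 1) := by
        rw [Real.Gamma_add_one hs.ne']; ring
      rw [mul_div_assoc, h1, Real.Gamma_eq_integral hs,
        Real.Gamma_eq_integral (by linarith : 0 < 1 - 1 / α + 1),
        ← integral_sub (Real.GammaIntegral_convergent hs)
          (Real.GammaIntegral_convergent (by linarith)), ← integral_const_mul]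
      refine setIntegral_congr_fun measurableSet_Ioi fun u hu => ?_
      rw [show 1 - 1 / α + 1 - 1 = 1 + -(1 / α) by ring, Real.rpow_add hu, Real.rpow_one,
        show 1 - 1 / α - 1 = -(1 / α) by ring]
      ring
    rw [hlim] at h
    refine h.congr' ?_
    filter_upwards [eventually_gt_atTop 0] with n hn
    have hn' : (0 : ℝ) < n := by exact_mod_cast hn
    rw [integral_mul_const, unseenMass_eq_integral hq (pos_of_zipf hc hZipf hq) hq1 hqs,
      sub_eq_add_neg, Real.rpow_add hn', Real.rpow_one, ← mul_assoc]
    congr 1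
    have := integral_comp_mul_left_Ioi
      (fun t => ((1 - t) ^ n - n * t * (1 - t) ^ (n - 1)) * levelCount q S t) 0 (inv_pos.2 hn')
    rw [mul_zero, inv_inv, smul_eq_mul] at this
    rw [mul_comm _ (n : ℝ), ← this]
    congr 1; ext u
    rw [div_eq_inv_mul, mul_inv_cancel_left₀ hn'.ne']
  · have hn' : (0 : ℝ) < n := by positivity
    have h0 : 0 ≤ 1 - u / n := sub_nonneg.2 ((div_le_one hn').2 hun)
    have h1 : 1 - u / n ≤ 1 := by linarith [div_pos hu hn']
    have h2 := one_sub_div_pow_pred_le hn hu hun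
    have h3 : (1 - u / n) ^ n ≤ (1 - u / n) ^ (n - 1) :=
      pow_le_pow_of_le_one h0 h1 (Nat.sub_le n 1)
    refine (abs_sub _ _).trans ?_
    rw [abs_of_nonneg (pow_nonneg h0 _), abs_of_nonneg (mul_nonneg hu.le (pow_nonneg h0 _)),
      add_mul, one_mul]
    exact add_le_add (h3.trans h2) (mul_le_mul_of_nonneg_left h2 hu.le)

end Asymptotics

/-! ### From the number of draws to the cache size -/

section Inversion

lemma tendsto_rpow_mul_exp_of_tendsto_div {e : ℝ → ℝ} {η : ℝ} (hη : η < 0)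
    (he : Tendsto (fun x => e x / x) atTop (𝓝 η)) (s : ℝ) :
    Tendsto (fun x => Real.exp (e x) * x ^ s) atTop (𝓝 0) := by
  refine squeeze_zero' ?_ ?_
    (tendsto_rpow_mul_exp_neg_mul_atTop_nhds_zero s (-(η / 2)) (by linarith))
  · filter_upwards [eventually_gt_atTop 0] with x hx
    positivity
  · filter_upwards [eventually_gt_atTop 0, he.eventually (gt_mem_nhds (by linarith : η < η / 2))]
      with x hx h
    rw [div_lt_iff₀ hx] at h
    rw [mul_comm, neg_neg]
    exact mul_le_mul_of_nonneg_left (Real.exp_le_exp.2 h.le) (by positivity)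

variable {α K : ℝ} (hα : 1 < α) (hK : 0 < K) {M B : ℕ → ℝ}
  (hM : Tendsto (fun n : ℕ => M n * (n : ℝ) ^ (-(1 / α))) atTop (𝓝 K))
  (hB : Tendsto (fun n : ℕ => B n * (n : ℝ) ^ (1 - 1 / α)) atTop (𝓝 (K / α)))

/-- The number of draws after which the expected number of distinct elements is about `ρ * x`. -/
noncomputable def characteristicTime (α K ρ x : ℝ) : ℕ := ⌊(ρ / K) ^ α * x ^ α⌋₊

include hα hK

lemma tendsto_characteristicTime_div {ρ : ℝ} (hρ : 0 < ρ) :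
    Tendsto (fun x : ℝ => (characteristicTime α K ρ x : ℝ) / x ^ α) atTop (𝓝 ((ρ / K) ^ α)) :=
  (tendsto_nat_floor_mul_div_atTop (by positivity : 0 ≤ (ρ / K) ^ α)).comp
    (tendsto_rpow_atTop (by linarith))

lemma tendsto_characteristicTime {ρ : ℝ} (hρ : 0 < ρ) :
    Tendsto (characteristicTime α K ρ) atTop atTop :=
  tendsto_nat_floor_atTop.comp
    ((tendsto_rpow_atTop (by linarith)).const_mul_atTop (by positivity))

include hM in
lemma tendsto_mean_characteristicTime {ρ : ℝ} (hρ : 0 < ρ) :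
    Tendsto (fun x => M (characteristicTime α K ρ x) / x) atTop (𝓝 ρ) := by
  have h1 := (tendsto_characteristicTime_div hα hK hρ).rpow_const (p := 1 / α)
    (Or.inl (by positivity))
  have h2 := (hM.comp (tendsto_characteristicTime hα hK hρ)).mul h1
  rw [← Real.rpow_mul (by positivity), mul_one_div_cancel (by positivity), Real.rpow_one,
    mul_div_cancel₀ _ hK.ne'] at h2
  refine h2.congr' ?_
  filter_upwards [eventually_gt_atTop 0,
    (tendsto_characteristicTime hα hK hρ).eventually_gt_atTop 0] with x hx hn
  have hn' : (0 : ℝ) < characteristicTime α K ρ x := by exact_mod_cast hn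
  simp only [Function.comp]
  rw [Real.div_rpow hn'.le (by positivity), ← Real.rpow_mul hx.le,
    mul_one_div_cancel (by positivity), Real.rpow_one, Real.rpow_neg hn'.le]
  have := (Real.rpow_pos_of_pos hn' (1 / α)).ne'
  field_simp

include hB in
lemma tendsto_unseen_characteristicTime {ρ : ℝ} (hρ : 0 < ρ) :
    Tendsto (fun x => B (characteristicTime α K ρ x) * x ^ (α - 1)) atTop
      (𝓝 (K ^ α / α * ρ ^ (1 - α))) := by
  have h1 := (tendsto_characteristicTime_div hα hK hρ).rpow_const (p := -(1 - 1 / α))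
    (Or.inl (by positivity))
  have h2 := (hB.comp (tendsto_characteristicTime hα hK hρ)).mul h1
  have hlim : K / α * ((ρ / K) ^ α) ^ (-(1 - 1 / α)) = K ^ α / α * ρ ^ (1 - α) := by
    have hexp : α * (-(1 - 1 / α)) = 1 - α := by field_simp; ring
    rw [← Real.rpow_mul (by positivity), hexp, Real.div_rpow hρ.le hK.le, Real.rpow_sub hK,
      Real.rpow_one]
    have := (Real.rpow_pos_of_pos hK α).ne'
    field_simp
  rw [hlim] at h2
  refine h2.congr' ?_
  filter_upwards [eventually_gt_atTop 0,
    (tendsto_characteristicTime hα hK hρ).eventually_gt_atTop 0] with x hx hn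
  have hn' : (0 : ℝ) < characteristicTime α K ρ x := by exact_mod_cast hn
  have hexp : α * (-(1 - 1 / α)) = -(α - 1) := by field_simp
  simp only [Function.comp]
  rw [Real.div_rpow hn'.le (by positivity), ← Real.rpow_mul hx.le, hexp, Real.rpow_neg hn'.le,
    Real.rpow_neg hx.le]
  have := (Real.rpow_pos_of_pos hn' (1 - 1 / α)).ne'
  field_simp

include hM in
-- The mean is about ρx, so the optimal Chernoff parameter is z = 1/ρ; the exponent per unit of x
-- tends to log ρ + 1 - ρ, negative for ρ ≠ 1.
lemma tendsto_chernoff_characteristicTime {ρ : ℝ} (hρ : 0 < ρ) (hρ1 : ρ ≠ 1) :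
    Tendsto (fun x => Real.exp (-(x * Real.log ρ⁻¹) +
      (ρ⁻¹ - 1) * M (characteristicTime α K ρ x)) * x ^ (α - 1)) atTop (𝓝 0) := by
  have hη : -Real.log ρ⁻¹ + (ρ⁻¹ - 1) * ρ < 0 := by
    have := Real.log_lt_sub_one_of_pos hρ hρ1
    rw [Real.log_inv, sub_mul, inv_mul_cancel₀ hρ.ne']
    linarith
  refine tendsto_rpow_mul_exp_of_tendsto_div hη ?_ _
  refine (((tendsto_mean_characteristicTime hα hK hM hρ).const_mul (ρ⁻¹ - 1)).const_add
    (-Real.log ρ⁻¹)).congr' ?_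
  filter_upwards [eventually_gt_atTop 0] with x hx
  field_simp

include hM hB in
/-- If `p x` is sandwiched between the unseen masses after `n` draws, up to Chernoff bounds for
the number of distinct elements, then `p x` is asymptotically the unseen mass at the time at
which `x` distinct elements are expected. -/
theorem tendsto_of_chernoff_sandwich {p : ℝ → ℝ}
    (hup : ∀ (n : ℕ) (z x : ℝ), 1 ≤ z →
      p x ≤ B n + Real.exp (-(x * Real.log z) + (z - 1) * M n))
    (hlo : ∀ (n : ℕ) (z x : ℝ), 0 < z → z ≤ 1 →
      B n - Real.exp (-(x * Real.log z) + (z - 1) * M n) ≤ p x) :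
    Tendsto (fun x => p x * x ^ (α - 1)) atTop (𝓝 (K ^ α / α)) := by
  have hcont : Tendsto (fun ρ : ℝ => K ^ α / α * ρ ^ (1 - α)) (𝓝 1) (𝓝 (K ^ α / α)) := by
    have h := ((continuousAt_id (x := (1 : ℝ))).rpow_const (p := 1 - α)
      (Or.inl one_ne_zero)).tendsto.const_mul (K ^ α / α)
    simpa using h
  refine tendsto_order.2 ⟨fun b hb => ?_, fun b hb => ?_⟩
  -- Lower bound: with ρ > 1 the mean exceeds x, and fewer than x distinct items is a rare event.
  · obtain ⟨ρ, hρb, hρ1⟩ := (((hcont.mono_left (nhdsWithin_le_nhds (s := Ioi 1))).eventually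
      (lt_mem_nhds hb)).and self_mem_nhdsWithin).exists
    have hρ1' : 1 < ρ := hρ1
    have hρ : 0 < ρ := by linarith
    have h := (tendsto_unseen_characteristicTime hα hK hB hρ).sub
      (tendsto_chernoff_characteristicTime hα hK hM hρ hρ1'.ne')
    rw [sub_zero] at h
    filter_upwards [h.eventually (lt_mem_nhds hρb), eventually_gt_atTop 0] with x hx hx0
    refine hx.trans_le ?_
    rw [← sub_mul]
    exact mul_le_mul_of_nonneg_right (hlo _ _ _ (inv_pos.2 hρ) (inv_le_one_of_one_le₀ hρ1'.le))
      (by positivity)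
  -- Upper bound: with ρ < 1 the mean is below x, and more than x distinct items is a rare event.
  · obtain ⟨ρ, ⟨hρb, hρ⟩, hρ1⟩ := ((((hcont.eventually (gt_mem_nhds hb)).and
      (lt_mem_nhds one_pos)).filter_mono (nhdsWithin_le_nhds (s := Iio 1))).and
      self_mem_nhdsWithin).exists
    have hρ1' : ρ < 1 := hρ1
    have h := (tendsto_unseen_characteristicTime hα hK hB hρ).add
      (tendsto_chernoff_characteristicTime hα hK hM hρ hρ1'.ne)
    rw [add_zero] at h
    filter_upwards [h.eventually (gt_mem_nhds hρb), eventually_gt_atTop 0] with x hx hx0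
    refine lt_of_le_of_lt ?_ hx
    rw [← add_mul]
    exact mul_le_mul_of_nonneg_right (hup _ _ _ ((one_le_inv₀ hρ).2 hρ1'.le))
      (by positivity)

end Inversion

/-! ### Move-to-front position versus distinct items in a window -/

section Position

variable {N : ℕ}

/-- An item in front of `d` was requested after the last access to `d`, hence inside the window; `d`
itself accounts for the added one. -/
lemma position_le_distinctCount (h : ℕ → Fin N) (r : ℤ → ℕ) (n : ℕ) (d : ℕ)
    (hd : ∃ l ∈ Finset.Ico (-(n : ℤ)) 0, r l = d) :
    position h r 0 d ≤ distinctCount {i | h i = h d} (Finset.Ico (-(n : ℤ)) 0) r := by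
  classical
  obtain ⟨l, hl, hld⟩ := hd
  rw [Finset.mem_Ico] at hl
  have hnot : d ∉ {d' | h d' = h d ∧ MoreRecent r 0 d' d} := by
    rintro ⟨-, k, hk, hkd, hall⟩
    exact hall k le_rfl hk hkd
  rw [position, ← Set.encard_insert_of_notMem hnot, distinctCount,
    ← Set.encard_coe_eq_coe_finsetCard]
  refine Set.encard_le_encard fun d' hd' => ?_
  simp only [Finset.coe_filter, Finset.mem_image, Finset.mem_Ico, Set.mem_ofPred_eq]
  rcases hd' with rfl | ⟨hh, k, hk, hkd, hall⟩
  · exact ⟨⟨l, hl, hld⟩, rfl⟩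
  · refine ⟨⟨k, ⟨?_, hk⟩, hkd⟩, hh⟩
    by_contra! hkn
    exact hall l (hkn.le.trans hl.1) hl.2 hld

/-- Every item of the server seen in the window is more recent than `d`. -/
lemma distinctCount_lt_position (h : ℕ → Fin N) (r : ℤ → ℕ) (n : ℕ) (d : ℕ)
    (hd : ∀ l ∈ Finset.Ico (-(n : ℤ)) 0, r l ≠ d) :
    (distinctCount {i | h i = h d} (Finset.Ico (-(n : ℤ)) 0) r : ℕ∞) + 1 ≤ position h r 0 d := by
  classical
  rw [position, distinctCount, ← Set.encard_coe_eq_coe_finsetCard]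
  refine add_le_add_left (Set.encard_le_encard fun d' hd' => ?_) 1
  simp only [Finset.coe_filter, Finset.mem_image, Finset.mem_Ico, Set.mem_ofPred_eq] at hd'
  obtain ⟨⟨k, hk, hkd⟩, hh⟩ := hd'
  exact ⟨hh, k, hk.2, hkd, fun l hkl hl0 => hd l (Finset.mem_Ico.2 ⟨hk.1.trans hkl, hl0⟩)⟩

lemma coe_lt_coe_natCast_iff (x : ℝ) (k : ℕ) :
    (x : EReal) < (((k : ℕ∞) : ENNReal) : EReal) ↔ x < k := by
  rw [ENat.toENNReal_coe]
  have : (((k : ℕ) : ENNReal) : EReal) = ((k : ℝ) : EReal) := by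
    rw [← ENNReal.coe_natCast, EReal.coe_nnreal_eq_coe_real, NNReal.coe_natCast]
  rw [this, EReal.coe_lt_coe_iff]

lemma lt_natCast_of_le {x : ℝ} {y : ℕ∞} {k : ℕ} (hy : y ≤ k)
    (hx : (x : EReal) < ((y : ENNReal) : EReal)) : x < k :=
  (coe_lt_coe_natCast_iff x k).1
    (hx.trans_le (EReal.coe_ennreal_le_coe_ennreal_iff.2 (ENat.toENNReal_le.2 hy)))

lemma lt_of_natCast_le {x : ℝ} {y : ℕ∞} {k : ℕ} (hy : k ≤ y) (hx : x < k) :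
    (x : EReal) < ((y : ENNReal) : EReal) :=
  ((coe_lt_coe_natCast_iff x k).2 hx).trans_le
    (EReal.coe_ennreal_le_coe_ennreal_iff.2 (ENat.toENNReal_le.2 hy))

variable {Ω : Type*} [MeasurableSpace Ω] {P : Measure Ω} [IsProbabilityMeasure P]
  {R : ℤ → Ω → ℕ} {q : ℕ → ℝ}

/-- The probability that the `0`-th request is processed by the server `m` and has search cost
larger than `x`, for a fixed hash function `h`. -/
noncomputable def jointMissProb (P : Measure Ω) (R : ℤ → Ω → ℕ) (h : ℕ → Fin N) (m : Fin N)
    (x : ℝ) : ℝ :=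
  P.real {ω | h (R 0 ω) = m ∧
    (x : EReal) < ((position h (fun k => R k ω) 0 (R 0 ω) : ENNReal) : EReal)}

lemma card_Ico_neg (n : ℕ) : (Finset.Ico (-(n : ℤ)) 0).card = n := by simp

variable (hRmeas : ∀ k, Measurable (R k)) (hRindep : iIndepFun R P)
  (hRlaw : ∀ k i, P.real {ω | R k ω = i} = q i) (h : ℕ → Fin N) (m : Fin N)
include hRmeas hRindep hRlaw

/-- On a miss, either the item is unseen in the window or the window holds more than x distinct
items of the server. -/
lemma jointMissProb_le (n : ℕ) {z : ℝ} (x : ℝ) (hz : 1 ≤ z) :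
    jointMissProb P R h m x ≤ unseenMass q {i | h i = m} n +
      Real.exp (-(x * Real.log z) + (z - 1) * expectedDistinct q {i | h i = m} n) := by
  set I := Finset.Ico (-(n : ℤ)) 0 with hI
  have h1 := measureReal_unseen hRmeas hRindep hRlaw {i | h i = m} (k := 0) (I := I) (by simp [hI])
  have h2 := measureReal_distinctCount_le hRmeas hRindep hRlaw (by linarith : 0 < z) I
    {i | h i = m} x (A := {ω | x < distinctCount {i | h i = m} I (fun k => R k ω)})
    (fun ω hω => by
      rw [← Real.rpow_natCast]
      exact Real.rpow_le_rpow_of_exponent_le hz (le_of_lt hω))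
  rw [card_Ico_neg] at h1 h2
  rw [← h1]
  refine le_trans ?_ (add_le_add_right h2 _)
  refine (measureReal_mono ?_).trans (measureReal_union_le _ _)
  rintro ω ⟨hm, hx⟩
  by_cases hs : ∃ l ∈ I, R l ω = R 0 ω
  · right
    have := position_le_distinctCount h (fun k => R k ω) n (R 0 ω) hs
    rw [hm] at this
    exact lt_natCast_of_le this hx
  · left
    push Not at hs
    exact ⟨hm, hs⟩

/-- An unseen item together with at least x distinct items of the server in the window forces a
miss. -/
lemma le_jointMissProb (n : ℕ) {z : ℝ} (x : ℝ) (hz : 0 < z) (hz1 : z ≤ 1) :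
    unseenMass q {i | h i = m} n -
      Real.exp (-(x * Real.log z) + (z - 1) * expectedDistinct q {i | h i = m} n) ≤
      jointMissProb P R h m x := by
  set I := Finset.Ico (-(n : ℤ)) 0 with hI
  have h1 := measureReal_unseen hRmeas hRindep hRlaw {i | h i = m} (k := 0) (I := I) (by simp [hI])
  have h2 := measureReal_distinctCount_le hRmeas hRindep hRlaw hz I
    {i | h i = m} x (A := {ω | (distinctCount {i | h i = m} I (fun k => R k ω) : ℝ) < x})
    (fun ω hω => by
      rw [← Real.rpow_natCast]
      exact Real.rpow_le_rpow_of_exponent_ge hz hz1 (le_of_lt hω))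
  rw [card_Ico_neg] at h1 h2
  rw [← h1, sub_le_iff_le_add]
  refine le_trans ?_ (add_le_add_right h2 _)
  refine (measureReal_mono ?_).trans (measureReal_union_le _ _)
  rintro ω ⟨hm, hs⟩
  by_cases hx : (distinctCount {i | h i = m} I (fun k => R k ω) : ℝ) < x
  · right; exact hx
  · left
    refine ⟨hm, ?_⟩
    have hm' : h (R 0 ω) = m := hm
    have := distinctCount_lt_position h (fun k => R k ω) n (R 0 ω) hs
    rw [hm'] at this
    refine lt_of_natCast_le (k := distinctCount {i | h i = m} I (fun k => R k ω) + 1)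
      (by exact_mod_cast this) ?_
    push_cast
    linarith [not_lt.1 hx]

/-- The asymptotics of the miss probability of a server to which items are hashed with positive
density. -/
theorem tendsto_jointMissProb {c α μ : ℝ} (hc : 0 < c) (hα : 1 < α)
    (hq : Antitone q) (hZipf : q ~[atTop] fun i => c / ((i : ℝ) + 1) ^ α) (hμ : 0 < μ)
    (hS : Tendsto (fun n : ℕ => (Nat.count (fun i => h i = m) n : ℝ) / n) atTop (𝓝 μ)) :
    Tendsto (fun x => jointMissProb P R h m x * x ^ (α - 1)) atTop
      (𝓝 ((μ * Real.Gamma (1 - 1 / α)) ^ α * c / α)) := by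
  have hqs : Summable q := (hasSum_law (hRmeas 0) (hRlaw 0)).summable
  have hq1 : ∀ i, q i ≤ 1 := fun i => hRlaw 0 i ▸ measureReal_le_one
  have hG : 0 < Real.Gamma (1 - 1 / α) :=
    Real.Gamma_pos_of_pos (by linarith [(div_lt_one (by linarith : 0 < α)).2 hα])
  have hS' : Tendsto (fun n : ℕ => (@Nat.count (· ∈ {i | h i = m})
      (fun _ => Classical.propDecidable _) n : ℝ) / n) atTop (𝓝 μ) := by
    refine hS.congr fun n => ?_
    congr!
  have hK : 0 < μ * c ^ (1 / α) * Real.Gamma (1 - 1 / α) := by positivity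
  have key := tendsto_of_chernoff_sandwich hα hK
    (tendsto_expectedDistinct hc hα hZipf hq hq1 hqs hS')
    (tendsto_unseenMass hc hα hZipf hq hq1 hqs hS')
    (fun n z x hz => jointMissProb_le hRmeas hRindep hRlaw h m n x hz)
    (fun n z x hz hz1 => le_jointMissProb hRmeas hRindep hRlaw h m n x hz hz1)
  -- It remains to see that K^α = (μ Γ(1 - 1/α))^α c.
  convert key using 3
  rw [mul_right_comm μ, Real.mul_rpow (by positivity : 0 ≤ μ * Real.Gamma (1 - 1 / α))
    (by positivity : 0 ≤ c ^ (1 / α)), ← Real.rpow_mul hc.le,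
    one_div_mul_cancel (by positivity), Real.rpow_one]

end Position

/-! ### Conditioning on the hash function -/

section Law

variable {N : ℕ}

lemma measurable_hash_eval :
    Measurable (fun p : (ℕ → Fin N) × (ℤ → ℕ) => p.1 (p.2 0)) := by
  have h : Measurable (fun p : ℕ × (ℕ → Fin N) => p.2 p.1) :=
    measurable_from_prod_countable_right fun i => measurable_pi_apply i
  have h0 : Measurable (fun p : (ℕ → Fin N) × (ℤ → ℕ) => p.2 0) :=
    (measurable_pi_apply 0).comp measurable_snd
  exact h.comp (h0.prodMk measurable_fst)

lemma measurable_position :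
    Measurable (fun p : (ℕ → Fin N) × (ℤ → ℕ) => position p.1 p.2 0 (p.2 0)) := by
  unfold position
  refine (Measurable.of_discrete (f := fun y : ℕ∞ => y + 1)).comp (measurable_encard.comp ?_)
  have hr : ∀ k : ℤ, Measurable (fun p : (ℕ → Fin N) × (ℤ → ℕ) => p.2 k) := fun k =>
    (measurable_pi_apply k).comp measurable_snd
  refine measurable_set_iff.2 fun d => ?_
  refine Measurable.and (p := fun p : (ℕ → Fin N) × (ℤ → ℕ) => p.1 d = p.1 (p.2 0)) ?_ ?_
  · exact measurableSet_setOfPred.1 (measurableSet_eq_fun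
      ((measurable_pi_apply d).comp measurable_fst) measurable_hash_eval)
  · refine Measurable.exists fun k => Measurable.and measurable_const (Measurable.and ?_ ?_)
    · exact measurableSet_setOfPred.1 (measurableSet_eq_fun (hr k) measurable_const)
    · refine Measurable.forall fun l => measurable_const.imp (measurable_const.imp ?_)
      exact (measurableSet_setOfPred.1 (measurableSet_eq_fun (hr l) (hr 0))).not

/-- The server of the `0`-th request and its search cost, as a function of the hash function and
the request sequence. -/
noncomputable def serverAndCost (p : (ℕ → Fin N) × (ℤ → ℕ)) : Fin N × ℕ∞ :=
  (p.1 (p.2 0), position p.1 p.2 0 (p.2 0))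

lemma measurable_serverAndCost : Measurable (serverAndCost (N := N)) :=
  measurable_hash_eval.prodMk measurable_position

lemma measurable_serverAndCost_right (h : ℕ → Fin N) :
    Measurable (fun r : ℤ → ℕ => serverAndCost (h, r)) :=
  measurable_serverAndCost.comp measurable_prodMk_left

variable {Ω : Type*} [MeasurableSpace Ω] {P : Measure Ω} [IsProbabilityMeasure P] [NeZero N]
  {H : ℕ → Ω → Fin N} {R : ℤ → Ω → ℕ}

omit [NeZero N] in
lemma measurable_serverAndCost_comp (hRmeas : ∀ n, Measurable (R n)) (h : ℕ → Fin N) :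
    Measurable (fun ω => serverAndCost (h, fun n => R n ω)) :=
  (measurable_serverAndCost_right h).comp (measurable_pi_lambda _ hRmeas)

/-- The conditional law of the server and the search cost given the hash function `h` is their
law for this fixed `h`. -/
theorem conditionalLaw_ae_eq (hHmeas : ∀ i, Measurable (H i)) (hRmeas : ∀ n, Measurable (R n))
    (hHR : IndepFun (fun ω n => R n ω) (fun ω i => H i ω) P) :
    ∀ᵐ ω ∂P, conditionalLaw P H R (fun i => H i ω) =
      P.map (fun ω' => serverAndCost (fun i => H i ω, fun n => R n ω')) := by
  have hH : Measurable (fun ω i => H i ω) := measurable_pi_lambda _ hHmeas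
  have hR : Measurable (fun ω n => R n ω) := measurable_pi_lambda _ hRmeas
  have : IsProbabilityMeasure (P.map fun ω n => R n ω) :=
    Measure.isProbabilityMeasure_map hR.aemeasurable
  have : IsProbabilityMeasure (P.map fun ω i => H i ω) :=
    Measure.isProbabilityMeasure_map hH.aemeasurable
  -- The candidate kernel freezes h and pushes the request law forward; uniqueness of the
  -- disintegration identifies it almost everywhere with the conditional law.
  let κ : Kernel (ℕ → Fin N) (Fin N × ℕ∞) :=
    (Kernel.id ×ₖ Kernel.const (ℕ → Fin N) (P.map fun ω n => R n ω)).map serverAndCost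
  have hκ : ∀ h, κ h = (P.map fun ω n => R n ω).map (fun r => serverAndCost (h, r)) := by
    intro h
    rw [Kernel.map_apply _ measurable_serverAndCost, Kernel.prod_apply, Kernel.id_apply,
      Kernel.const_apply, Measure.dirac_prod, Measure.map_map measurable_serverAndCost
        measurable_prodMk_left]
    rfl
  have hκm : IsMarkovKernel κ := Kernel.IsMarkovKernel.map _ measurable_serverAndCost
  have hjoint : P.map (fun ω => ((fun i => H i ω, fun n => R n ω) :
      (ℕ → Fin N) × (ℤ → ℕ))) = (P.map fun ω i => H i ω).prod (P.map fun ω n => R n ω) :=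
    (indepFun_iff_map_prod_eq_prod_map_map hH.aemeasurable hR.aemeasurable).1 hHR.symm
  have hcomp : P.map (fun ω => ((fun i => H i ω), (server H R 0 ω, searchCost H R 0 ω))) =
      (P.map fun ω i => H i ω) ⊗ₘ κ := by
    ext s hs
    have hg : Measurable (fun p : (ℕ → Fin N) × (ℤ → ℕ) => (p.1, serverAndCost p)) :=
      measurable_fst.prodMk measurable_serverAndCost
    have h1 : P.map (fun ω => ((fun i => H i ω), (server H R 0 ω, searchCost H R 0 ω))) =
        ((P.map fun ω i => H i ω).prod (P.map fun ω n => R n ω)).map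
          (fun p => (p.1, serverAndCost p)) := by
      rw [← hjoint, Measure.map_map hg (hH.prodMk hR)]
      rfl
    rw [h1, Measure.map_apply hg hs, Measure.prod_apply (hg hs), Measure.compProd_apply hs]
    refine lintegral_congr fun h => ?_
    rw [hκ, Measure.map_apply (measurable_serverAndCost_right h) (measurable_prodMk_left hs)]
    rfl
  have hY : Measurable (fun ω => (server H R 0 ω, searchCost H R 0 ω)) :=
    measurable_serverAndCost.comp (hH.prodMk hR)
  have hae := condDistrib_ae_eq_of_measure_eq_compProd (fun ω i => H i ω) hY.aemeasurable hcomp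
  filter_upwards [ae_of_ae_map hH.aemeasurable hae] with ω hω
  rw [conditionalLaw, hω, hκ, Measure.map_map (measurable_serverAndCost_right _) hR]
  rfl

variable {h : ℕ → Fin N} (hRmeas : ∀ n, Measurable (R n))
  (hlaw : conditionalLaw P H R h = P.map (fun ω => serverAndCost (h, fun n => R n ω)))
include hRmeas hlaw

lemma serverProb_eq (m : Fin N) : serverProb P H R h m = P.real {ω | h (R 0 ω) = m} := by
  rw [serverProb, hlaw, map_measureReal_apply (measurable_serverAndCost_comp hRmeas h)
    (s := {y : Fin N × ℕ∞ | y.1 = m}) (measurable_fst (measurableSet_singleton m))]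
  rfl

lemma serverMissProb_eq (m : Fin N) (x : ℝ) :
    serverMissProb P H R h m x = (serverProb P H R h m)⁻¹ * jointMissProb P R h m x := by
  have hm : MeasurableSet {y : Fin N × ℕ∞ | y.1 = m} :=
    measurable_fst (measurableSet_singleton m)
  have hx : MeasurableSet {y : Fin N × ℕ∞ | (x : EReal) < ((y.2 : ENNReal) : EReal)} :=
    measurable_snd (MeasurableSet.of_discrete
      (s := {y : ℕ∞ | (x : EReal) < ((y : ENNReal) : EReal)}))
  rw [serverMissProb, measureReal_def, cond_apply hm, ENNReal.toReal_mul, ENNReal.toReal_inv]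
  congr 1
  rw [hlaw, ← measureReal_def, map_measureReal_apply
    (measurable_serverAndCost_comp hRmeas h) (hm.inter hx)]
  rfl

lemma serverMissProb_mul_serverProb (m : Fin N) (x : ℝ) :
    serverMissProb P H R h m x * serverProb P H R h m = jointMissProb P R h m x := by
  rw [serverMissProb_eq hRmeas hlaw, mul_comm _ (jointMissProb P R h m x), mul_assoc]
  -- For a server of probability zero the inverse is 0 by convention, and the joint probability
  -- vanishes too.
  rcases eq_or_ne (serverProb P H R h m) 0 with h0 | h0
  · have hle : jointMissProb P R h m x ≤ 0 := by
      rw [← h0, serverProb_eq hRmeas hlaw]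
      exact measureReal_mono fun ω hω => hω.1
    rw [le_antisymm hle measureReal_nonneg, zero_mul]
  · rw [inv_mul_cancel₀ h0, mul_one]

end Law

/-! ### Almost sure density of the items of a server -/

section Density

variable {Ω : Type*} [MeasurableSpace Ω] {P : Measure Ω} [IsProbabilityMeasure P] {N : ℕ}
  {H : ℕ → Ω → Fin N} {μ : Fin N → ℝ} (hHmeas : ∀ i, Measurable (H i))
  (hHlaw : ∀ i m, P.real {ω | H i ω = m} = μ m)
include hHmeas hHlaw

lemma tendsto_count_hash_div (hHindep : iIndepFun H P) (m : Fin N) :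
    ∀ᵐ ω ∂P, Tendsto (fun n : ℕ => (Nat.count (fun i => H i ω = m) n : ℝ) / n) atTop
      (𝓝 (μ m)) := by
  let f : Fin N → ℝ := fun j => if j = m then 1 else 0
  have hf : Measurable f := Measurable.of_discrete
  have hmap : ∀ i, P.map (H i) = P.map (H 0) := by
    intro i
    have h1 := Measure.isProbabilityMeasure_map (μ := P) (hHmeas i).aemeasurable
    have h2 := Measure.isProbabilityMeasure_map (μ := P) (hHmeas 0).aemeasurable
    refine Measure.ext_of_singleton fun j => ?_
    rw [← measureReal_eq_measureReal_iff,
      map_measureReal_apply (hHmeas i) (measurableSet_singleton j),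
      map_measureReal_apply (hHmeas 0) (measurableSet_singleton j)]
    exact (hHlaw i j).trans (hHlaw 0 j).symm
  have hmean : P[fun ω => f (H 0 ω)] = μ m := by
    have : (fun ω => f (H 0 ω)) = {ω | H 0 ω = m}.indicator 1 := by
      ext ω; by_cases h : H 0 ω = m <;> simp [f, h]
    rw [this, integral_indicator_one (s := {ω | H 0 ω = m}) (hHmeas 0 (measurableSet_singleton m))]
    exact hHlaw 0 m
  have h := strong_law_ae_real (μ := P) (fun i ω => f (H i ω))
    (integrable_of_bounded (hf.comp (hHmeas 0)) 1 fun ω => by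
      by_cases h : H 0 ω = m <;> simp [f, h])
    (fun i j hij => (hHindep.indepFun hij).comp hf hf)
    (fun i => (IdentDistrib.mk (hHmeas i).aemeasurable (hHmeas 0).aemeasurable (hmap i)).comp hf)
  rw [hmean] at h
  filter_upwards [h] with ω hω
  refine hω.congr fun n => ?_
  rw [Nat.count_eq_card_filter_range, Finset.card_filter, Nat.cast_sum]
  congr 1
  refine Finset.sum_congr rfl fun i _ => ?_
  by_cases h : H i ω = m <;> simp [f, h]

omit hHmeas in
-- Being equivalent to the zero function means vanishing eventually, so density zero would not
-- suffice for such a server: it must receive no item at all.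
lemma ae_hash_ne_of_eq_zero {m : Fin N} (hm : μ m = 0) : ∀ᵐ ω ∂P, ∀ i, H i ω ≠ m := by
  refine ae_all_iff.2 fun i => ?_
  have h := hHlaw i m
  rw [hm, measureReal_eq_zero_iff] at h
  exact measure_eq_zero_iff_ae_notMem.1 h

end Density

/-- Nonnegativity excludes cancellation: each `g i` is bounded by the total, so each error is
negligible against it, however the terms compare with one another. -/
lemma isEquivalent_sum_of_nonneg {α ι : Type*} {l : Filter α} (s : Finset ι)
    {f g : ι → α → ℝ} (hfg : ∀ i ∈ s, f i ~[l] g i) (hg : ∀ i ∈ s, ∀ᶠ x in l, 0 ≤ g i x) :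
    (fun x => ∑ i ∈ s, f i x) ~[l] fun x => ∑ i ∈ s, g i x := by
  have hO : ∀ i ∈ s, g i =O[l] fun x => ∑ i ∈ s, g i x := by
    intro i hi
    refine IsBigO.of_bound' ?_
    filter_upwards [(Filter.eventually_all_finset s).2 hg] with x hx
    rw [Real.norm_of_nonneg (hx i hi), Real.norm_of_nonneg (Finset.sum_nonneg hx)]
    exact Finset.single_le_sum hx hi
  have h := IsLittleO.sum fun i hi => (hfg i hi).isLittleO.trans_isBigO (hO i hi)
  refine h.congr_left fun x => ?_
  simp [Finset.sum_sub_distrib]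

end LRUCluster

theorem theorem1 {Ω : Type*} [MeasurableSpace Ω] (P : Measure Ω) [IsProbabilityMeasure P]
    {N : ℕ} [NeZero N] (μ : Fin N → ℝ) (q : ℕ → ℝ) (c α : ℝ) (hc : 0 < c) (hα : 1 < α)
    -- Items are numbered from `0`; `H i` is the server to which item `i` is hashed.
    (H : ℕ → Ω → Fin N) (hHmeas : ∀ i, Measurable (H i))
    (hHindep : iIndepFun H P) (hHlaw : ∀ i m, P.real {ω | H i ω = m} = μ m)
    -- `R n` is the item requested at the `n`-th arrival.
    (R : ℤ → Ω → ℕ) (hRmeas : ∀ n, Measurable (R n))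
    (hRindep : iIndepFun R P) (hRlaw : ∀ n i, P.real {ω | R n ω = i} = q i)
    -- The request sequence does not depend on the choice of the hash function.
    (hHR : IndepFun (fun ω n => R n ω) (fun ω i => H i ω) P)
    -- The item popularities are non-increasing and follow a Zipf law.
    (hq : Antitone q) (hZipf : q ~[atTop] fun i => c / ((i : ℝ) + 1) ^ α) :
    ∀ᵐ ω ∂P,
      (∀ m, 0 < μ m →
        (fun x : ℝ => LRUCluster.serverMissProb P H R (fun i => H i ω) m x) ~[atTop]
          fun x : ℝ => (μ m * Real.Gamma (1 - 1 / α)) ^ α * c *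
            (1 / LRUCluster.serverProb P H R (fun i => H i ω) m) / (α * x ^ (α - 1))) ∧
      -- The limit in which all the cache sizes tend to infinity, in any manner.
      (fun x : Fin N → ℝ => LRUCluster.clusterMissProb P H R (fun i => H i ω) x) ~[atTop]
        fun x : Fin N → ℝ =>
          ∑ m, μ m ^ α * Real.Gamma (1 - 1 / α) ^ α * c / (α * x m ^ (α - 1)) := by
  have hG : 0 < Real.Gamma (1 - 1 / α) :=
    Real.Gamma_pos_of_pos (by linarith [(div_lt_one (by linarith : 0 < α)).2 hα])
  have hμ0 : ∀ m, 0 ≤ μ m := fun m => hHlaw 0 m ▸ measureReal_nonneg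
  filter_upwards [LRUCluster.conditionalLaw_ae_eq hHmeas hRmeas hHR,
    ae_all_iff.2 fun m => LRUCluster.tendsto_count_hash_div hHmeas hHlaw hHindep m,
    ae_all_iff.2 fun m => ae_all_iff.2 fun hm : μ m = 0 =>
      LRUCluster.ae_hash_ne_of_eq_zero hHlaw hm] with ω hlaw hdens hzero
  have hjoint : ∀ m, 0 < μ m →
      (fun x : ℝ => LRUCluster.jointMissProb P R (fun i => H i ω) m x) ~[atTop]
        fun x : ℝ => (μ m * Real.Gamma (1 - 1 / α)) ^ α * c / (α * x ^ (α - 1)) := by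
    intro m hm
    have hpos : 0 < (μ m * Real.Gamma (1 - 1 / α)) ^ α * c / α := by positivity
    have ht := (LRUCluster.tendsto_jointMissProb hRmeas hRindep hRlaw (fun i => H i ω) m hc hα hq
      hZipf hm (hdens m)).div_const ((μ m * Real.Gamma (1 - 1 / α)) ^ α * c / α)
    rw [div_self hpos.ne'] at ht
    have hne : ∀ᶠ x : ℝ in atTop,
        (μ m * Real.Gamma (1 - 1 / α)) ^ α * c / (α * x ^ (α - 1)) ≠ 0 := by
      filter_upwards [eventually_gt_atTop 0] with x hx
      positivity
    refine (isEquivalent_iff_tendsto_one hne).2 (ht.congr' ?_)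
    filter_upwards [eventually_gt_atTop 0] with x hx
    have hx' : x ^ (α - 1) ≠ 0 := by positivity
    simp only [Pi.div_apply]
    field_simp
  refine ⟨fun m hm => ?_, ?_⟩
  · refine ((IsEquivalent.refl (u := fun _ : ℝ =>
      (LRUCluster.serverProb P H R (fun i => H i ω) m)⁻¹)).mul (hjoint m hm)).congr_left ?_
      |>.congr_right ?_
    · exact Eventually.of_forall fun x =>
        (LRUCluster.serverMissProb_eq hRmeas hlaw m x).symm
    · refine Eventually.of_forall fun x => ?_
      simp only [Pi.mul_apply]
      ring
  · unfold LRUCluster.clusterMissProb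
    simp_rw [LRUCluster.serverMissProb_mul_serverProb hRmeas hlaw]
    refine LRUCluster.isEquivalent_sum_of_nonneg Finset.univ (fun m _ => ?_) (fun m _ => ?_)
    · rcases (hμ0 m).eq_or_lt with hm | hm
      · have h0 : ∀ x, LRUCluster.jointMissProb P R (fun i => H i ω) m x = 0 := by
          intro x
          have : {ω' | H (R 0 ω') ω = m ∧ (x : EReal) <
              ((LRUCluster.position (fun i => H i ω) (fun k => R k ω') 0 (R 0 ω') : ENNReal) :
                EReal)} = ∅ :=
            Set.eq_empty_of_forall_notMem fun ω' hω' => hzero m hm.symm _ hω'.1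
          rw [LRUCluster.jointMissProb, this, measureReal_empty]
        simp_rw [h0, ← hm, Real.zero_rpow (by linarith : α ≠ 0), zero_mul, zero_div]
        exact IsEquivalent.refl
      -- In the product order `atTop` sends every coordinate to infinity, with no relation between
      -- their speeds.
      · have hproj : Tendsto (fun x : Fin N → ℝ => x m) atTop atTop :=
          tendsto_atTop.2 fun b => by
            filter_upwards [eventually_ge_atTop (fun _ : Fin N => b)] with x hx
            exact hx m
        have h := (hjoint m hm).comp_tendsto hproj
        rw [Real.mul_rpow hm.le hG.le] at h
        exact h
    · filter_upwards [eventually_ge_atTop (fun _ : Fin N => (0 : ℝ))] with x hx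
      have hxm : 0 ≤ x m := hx m
      have := hμ0 m
      positivity
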